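/- **Setting.** Bits $s^t_x\in\mathbb Z_2$ evolve under Rule 54: in the step leading to time $t$ every site $x\equiv t \pmod 2$ is updated by $s^{t}_x=\chi(s^{t-1}_{x-1},s^{t-1}_x,s^{t-1}_{x+1})$, $\chi(a,b,c)=a+b+c+ac \pmod 2$, and the other sites keep their value. For $\xi,\omega>0$ let $$W_0(\xi,\omega)=\begin{bmatrix}1&0&0\\ \xi&0&0\\ 1&0&0\end{bmatrix},\quad W_1(\xi,\omega)=\begin{bmatrix}0&\xi&0\\0&0&1\\0&0&\omega\end{bmatrix},\quad W'_s(\xi,\omega)=W_s(\omega,\xi),$$ $T=(W_0+W_1)(W'_0+W'_1)$, $T'=(W'_0+W'_1)(W_0+W_1)$. The two-parameter GGE $p$ gives a word $s_1\cdots s_{2k}$ of adjacent sites, whose first site is on the lower row of the saw (sites updated last), the probability $p_{\downarrow}(s_1\cdots s_{2k})=\lim_{N\to\infty}\operatorname{tr}(W_{s_1}W'_{s_2}\cdots W'_{s_{2k}}T^{N-k})/\operatorname{tr}T^N$; if the first site is on the upper row, $p_{\uparrow}$ is obtained by exchanging $W\leftrightarrow W'$, $T\leftrightarrow T'$ in the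 numerator; for odd length one sums over one further bit. At time $0$ even sites form the lower row. The filling probabilities of left- and right-movers are $p_l=p_\downarrow(001)/p_\downarrow(00)$ and $p_r=p_\downarrow(100)/p_\uparrow(00)$. The time-state $q_{b_0\ldots b_{m-1}}$ is the probability, under $p$ at time $0$, that $s^t_{t\bmod 2}=b_t$ for $t=0,\dots,m-1$ (a finite sum over the initial values on the sites $-m,\dots,m$). Put $\rho(t)=s^t_0$ (as a number $0$ or $1$), $\rho=\rho(0)$, and $C(0,t)=\langle\rho(t)\rho\rangle_p-\langle\rho(t)\rangle_p\langle\rho\rangle_p$. Let $$A_0=\begin{bmatrix}1-p_r&0&0\\0&0&0\\1&0&0\end{bmatrix},\ A_1=\begin{bmatrix}0&p_r&0\\0&0&1\\0&0&0\end{bmatrix},\ A'_s(p_r,p_l)=A_s(p_l,p_r),\ \langle L|=\frac{[1\ \ p_l\ \ p_r]}{1+p_r+p_l},\ |R\rangle=\begin{bmatrix}1\\1\\1\end{bmatrix}.$$ **Theorem.** For all $\xi,\omega>0$: 1. The limits defining $p$ exist for all words; $0<p_l,p_r<1$; $p_l=p_\downarrow(010)/p_\downarrow(01)$, $p_r=p_\downarrow(010)/p_\uparrow(10)$;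 and $\xi=\frac{p_l(1-p_r)}{(1-p_l)^2}$, $\omega=\frac{p_r(1-p_l)}{(1-p_r)^2}$. 2. For every $m\ge 0$, $q$ is a probability distribution on $\mathbb Z_2^m$, and $q_{b_0\ldots b_{m-1}}\ne 0$ if and only if $b$ contains neither $010$ nor $111$ as three consecutive bits. 3. (Markov property.) For $m\ge 3$ and $q_{b_0\ldots b_{m-1}}\neq0$, $$\frac{q_{b_0\ldots b_m}}{q_{b_0\ldots b_{m-1}}}=f_{\theta}(b_{m-3},b_{m-2},b_{m-1},b_m),\qquad \theta=p_l \text{ for odd } m,\quad \theta=p_r\text{ for even } m,$$ where $f_\theta(s,0,0,1)=f_\theta(1,1,0,1)=\theta$, $f_\theta(s,0,0,0)=f_\theta(1,1,0,0)=1-\theta$, $f_\theta(s,0,1,1)=f_\theta(0,1,1,0)=1$, $f_\theta(s,0,1,0)=f_\theta(0,1,1,1)=0$ for $s\in\{0,1\}$. 4. (Matrix product form.) For all $m\ge0$, $q_{b_0\ldots b_{m-1}}=\langle L|A_{b_0}A'_{b_1}A_{b_2}\cdots A^{(\prime)}_{b_{m-1}}|R\rangle$. 5. For every even $t\ge2$,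 $$C(0,t)=\langle L|A_1\big((A'_0+A'_1)(A_0+A_1)\big)^{t/2-1}(A'_0+A'_1)A_1|R\rangle-\langle L|A_1|R\rangle^2 .$$ 6. Let $\Lambda_{1,2}=-\tfrac12\big(p_l+p_r-p_lp_r\pm\sqrt{(p_l+p_r-p_lp_r)^2-4p_lp_r}\big)\in\mathbb C$. The eigenvalues of $(A'_0+A'_1)(A_0+A_1)$, with multiplicity, are $1,\Lambda_1,\Lambda_2$, and $|\Lambda_{1,2}|<1$. If $\Lambda_1\ne\Lambda_2$, then for every even $t\ge 2$ $$C(0,t)=-\frac{(\Lambda_1^{t/2}-\Lambda_2^{t/2})\big((p_l+p_r)^2-p_lp_r(1+p_l+p_r)\big)+(\Lambda_1^{(t-2)/2}-\Lambda_2^{(t-2)/2})\,p_lp_r(p_l+p_r)}{(1+p_l+p_r)^2(\Lambda_1-\Lambda_2)} ;$$ if $\Lambda_1=\Lambda_2=\Lambda$, the same holds with each quotient $(\Lambda_1^{j}-\Lambda_2^{j})/(\Lambda_1-\Lambda_2)$ replaced by $j\Lambda^{j-1}$ (which is $0$ for $j=0$). -/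

import Mathlib

open scoped Matrix Topology
open Filter

namespace Rule54

/-- Values of a lattice site. -/
abbrev Bit := ZMod 2

/-! ### Deterministic dynamics -/

/-- The local update rule with binary code 54. -/
def chi (a b c : Bit) : Bit := a + b + c + a * c

/-- `evolve s t x` is the value at site `x` after `t` time steps, started from the saw `s` at time
`0`. In the step that leads to time `t`, exactly the sites of the same parity as `t` are updated, so
in the saw `s` the even sites carry time label `0` and the odd sites time label `-1`. -/
def evolve (s : ℤ → Bit) : ℕ → ℤ → Bit
  | 0, x => s x
  | t + 1, x =>
      if Even (x + ((t : ℤ) + 1)) then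
        chi (evolve s t (x - 1)) (evolve s t x) (evolve s t (x + 1))
      else evolve s t x

/-! ### Two-parameter generalised Gibbs states -/

/-- The matrices `W_s(ξ, ω)`; the primed ones are `W'_s(ξ, ω) = W_s(ω, ξ)`. -/
def W (ξ ω : ℝ) (s : Bit) : Matrix (Fin 3) (Fin 3) ℝ :=
  if s = 0 then !![1, 0, 0; ξ, 0, 0; 1, 0, 0] else !![0, ξ, 0; 0, 0, 1; 0, 0, ω]

/-- The transfer matrix `T = (W_0 + W_1)(W'_0 + W'_1)`. -/
def T (ξ ω : ℝ) : Matrix (Fin 3) (Fin 3) ℝ :=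
  (W ξ ω 0 + W ξ ω 1) * (W ω ξ 0 + W ω ξ 1)

/-- The alternating product `W_{s₁} W'_{s₂} W_{s₃} ⋯`. -/
def wordW (ξ ω : ℝ) : List Bit → Matrix (Fin 3) (Fin 3) ℝ
  | [] => 1
  | s :: w => W ξ ω s * wordW ω ξ w

/-- The trace over a ring of `2N` sites in which the first sites carry the word `w`, the remaining
ones are summed over, and the matrices alternate starting from `W(ξ, ω)`. It is meant for
`w.length ≤ 2N`. -/
def ringWeight (ξ ω : ℝ) (N : ℕ) (w : List Bit) : ℝ :=
  (wordW ξ ω w * (if Even w.length then 1 else W ω ξ 0 + W ω ξ 1) *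
    T ξ ω ^ (N - (w.length + 1) / 2)).trace

/-- The two rows of the saw: sites of the `lower` row were updated last (matrices `W`), sites of
the `upper` row are one time step older (matrices `W'`). -/
inductive Row
  | lower
  | upper
  deriving DecidableEq

/-- Probability, on the ring of `2N` sites, of the word `w` read from left to right, the first
letter being on the given row. -/
noncomputable def ringProb (ξ ω : ℝ) (r : Row) (N : ℕ) (w : List Bit) : ℝ :=
  match r with
  | .lower => ringWeight ξ ω N w / (T ξ ω ^ N).trace
  | .upper => ringWeight ω ξ N w / (T ξ ω ^ N).trace

/-- Asymptotic probability of the word `w` in an infinite system. -/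
noncomputable def blockProb (ξ ω : ℝ) (r : Row) (w : List Bit) : ℝ :=
  limUnder atTop (fun N : ℕ => ringProb ξ ω r N w)

/-- The row of site `-m` in the saw at time `0`, where even sites form the lower row. -/
def startRow (m : ℕ) : Row := if Even m then .lower else .upper

/-- The configuration with values `s` on the sites `-m, …, m`; the value `0` elsewhere is
immaterial, since only observables supported in this window are evaluated. -/
def extend (m : ℕ) (s : Fin (2 * m + 1) → Bit) (x : ℤ) : Bit :=
  if h : -(m : ℤ) ≤ x ∧ x ≤ (m : ℤ) then s ⟨(x + m).toNat, by omega⟩ else 0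

/-- Expectation in the stationary state of an observable `f` that depends only on the sites
`-m, …, m`. -/
noncomputable def expect (ξ ω : ℝ) (m : ℕ) (f : (ℤ → Bit) → ℝ) : ℝ :=
  ∑ s : Fin (2 * m + 1) → Bit, blockProb ξ ω (startRow m) (List.ofFn s) * f (extend m s)

/-- Conditional probability of a left-mover, given that the neighbouring left ray is empty. -/
noncomputable def leftFilling (ξ ω : ℝ) : ℝ :=
  blockProb ξ ω .lower [0, 0, 1] / blockProb ξ ω .lower [0, 0]

/-- Conditional probability of a right-mover, given that the neighbouring right ray is empty. -/
noncomputable def rightFilling (ξ ω : ℝ) : ℝ :=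
  blockProb ξ ω .lower [1, 0, 0] / blockProb ξ ω .upper [0, 0]

/-! ### Time-states and one-site correlations -/

/-- The time-state: probability that the values `s^0_0, s^1_1, s^2_0, s^3_1, …` observed at
times `0, …, m - 1` on the sites `0, 1, 0, 1, …` are `b 0, …, b (m - 1)`. -/
noncomputable def timeState (ξ ω : ℝ) (m : ℕ) (b : Fin m → Bit) : ℝ :=
  expect ξ ω m fun s =>
    if ∀ t : Fin m, evolve s (t : ℕ) (((t : ℕ) % 2 : ℕ) : ℤ) = b t then 1 else 0

/-- The density at site `0` and time `t`. -/
def density (t : ℕ) (s : ℤ → Bit) : ℝ := if evolve s t 0 = 1 then 1 else 0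

/-- The connected density-density correlation function at one site. -/
noncomputable def corr (ξ ω : ℝ) (t : ℕ) : ℝ :=
  expect ξ ω t (fun s => density t s * density 0 s)
    - expect ξ ω t (density t) * expect ξ ω t (density 0)

/-! ### The matrix product form of the time-state -/

/-- The matrices `A_s(p_r, p_l)`; the primed ones are `A'_s(p_r, p_l) = A_s(p_l, p_r)`. -/
def A (pr _pl : ℝ) (s : Bit) : Matrix (Fin 3) (Fin 3) ℝ :=
  if s = 0 then !![1 - pr, 0, 0; 0, 0, 0; 1, 0, 0] else !![0, pr, 0; 0, 0, 1; 0, 0, 0]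

/-- The alternating product `A_{b₀} A'_{b₁} A_{b₂} ⋯`. -/
def wordA (pr pl : ℝ) : List Bit → Matrix (Fin 3) (Fin 3) ℝ
  | [] => 1
  | b :: w => A pr pl b * wordA pl pr w

/-- The left boundary vector. -/
noncomputable def vecL (pr pl : ℝ) : Fin 3 → ℝ := (1 / (1 + pr + pl)) • ![1, pl, pr]

/-- The right boundary vector. -/
def vecR : Fin 3 → ℝ := ![1, 1, 1]

/-- The matrix element `⟨L| M |R⟩`. -/
noncomputable def sandwich (pr pl : ℝ) (M : Matrix (Fin 3) (Fin 3) ℝ) : ℝ :=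
  vecL pr pl ⬝ᵥ (M *ᵥ vecR)

/-- The sums `A_0 + A_1`. -/
def sumA (pr pl : ℝ) : Matrix (Fin 3) (Fin 3) ℝ := A pr pl 0 + A pr pl 1

/-- Three consecutive bits that are never observed at one site. -/
def Forbidden (a b c : Bit) : Prop :=
  (a = 0 ∧ b = 1 ∧ c = 0) ∨ (a = 1 ∧ b = 1 ∧ c = 1)

instance (a b c : Bit) : Decidable (Forbidden a b c) := by
  unfold Forbidden; infer_instance

/-- No three consecutive bits are forbidden. -/
def Accessible {m : ℕ} (b : Fin m → Bit) : Prop :=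
  ∀ (i : ℕ) (h : i + 2 < m), ¬ Forbidden (b ⟨i, by omega⟩) (b ⟨i + 1, by omega⟩) (b ⟨i + 2, h⟩)

/-- Conditional probability of the bit `d` after the bits `a, b, c`, where `p` is the probability
of a new soliton. The value after a forbidden triple is a convention. -/
def condProb (p : ℝ) (a b c d : Bit) : ℝ :=
  if Forbidden a b c then 0
  else if c = 0 then (if d = 1 then p else 1 - p)
  else if b = 0 then (if d = 1 then 1 else 0)
  else (if d = 1 then 0 else 1)

end Rule54

open Rule54

namespace Rule54

/-! The bits seen on the zigzag of sites 0 and 1 form a Markov chain because each half-line acts on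
its boundary site as a memoryless source of incoming solitons, with filling `x` (left-movers, from
the right) or `y` (right-movers, from the left).

The stationary state: for suitable `x`, `y` (`exists_isFilling`), diagonal matrices turn the `W_s`
into matrices `P_s` whose sum is stochastic, and positivity of the two-step matrix gives the limits
of the ring probabilities (`tendsto_ringProb`). Products of two matrices `P_s` have rank at most
one, so the state is a chain of memory two in both directions; given the sites 0 and 1, the two
outer half-lines are independent (`statProb_chain`, `window_sum`).

The dynamics: once the histories ("columns") of the sites 0 and 1 are prescribed, the right
half-line is driven by site 0 and the left one by site 1 (`evolve_columns_iff`). The core is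
`FixedColumnLaw`: given the past of the first site of a driven half-line, its next value has law
`condProb`. The proof is by induction on the number of sites, since the column of the first site
drives the remaining half-line. The law of the second site, inserted into `chi`, reproduces the same
law for the first site whatever the second column is, with one exception: if the first site is 1 and
the driver goes from 1 to 0, the next value copies an earlier value of the second site, and
`bath_second_site` shows that this value is a fresh Bernoulli variable.

Each new zigzag bit advances only one of the two half-lines, so its conditional probability is
`condProb` with alternating filling (`observedProb_step`). The matrices `A_s` obey the same
recursion (`sandwich_step`), and words of at most three letters are compared directly
(`observedProb_eq_sandwich`). Normalisation, support and correlations are then statements about the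
`A_s`. For the closed form, a quadratic polynomial in the two-step matrix is a multiple of the
projection on its stationary state (`sumA_quadratic`), so the connected correlation obeys a
homogeneous recursion with characteristic roots `Λ₁`, `Λ₂`. -/

/-! ### Markov chains of memory two on a half-line -/

/-- A bit that equals `1` with probability `x`. -/
def bern (x : ℝ) (c : Bit) : ℝ := if c = 1 then x else 1 - x

/-- Conditional probability, in the stationary state, of the bit `c` that follows `a, b`; `x` is the
filling probability belonging to the row of `c`, and `y` belongs to the other row. -/
def nextProb (x y : ℝ) (a b c : Bit) : ℝ :=
  if b = 0 then bern x c else if a = 0 then bern (1 - x) c else bern y c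

/-- Conditional probability of the word that follows `a, b`. -/
def chainWeight (x y : ℝ) (a b : Bit) : List Bit → ℝ
  | [] => 1
  | c :: w => nextProb x y a b c * chainWeight y x b c w

/-- Prepend a value to a sequence. -/
def consSeq (a : Bit) (s : ℕ → Bit) : ℕ → Bit
  | 0 => a
  | k + 1 => s k

/-- Continue a finite word by zeros. -/
def pad {N : ℕ} (s : Fin N → Bit) (k : ℕ) : Bit := if h : k < N then s ⟨k, h⟩ else 0

/-- Expectation of `F` over the `N` sites that follow `a, b`. -/
def chainExp (x y : ℝ) (a b : Bit) (N : ℕ) (F : (ℕ → Bit) → ℝ) : ℝ :=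
  ∑ s : Fin N → Bit, chainWeight x y a b (List.ofFn s) * F (pad s)

theorem sum_bit {M : Type*} [AddCommMonoid M] (F : Bit → M) : ∑ c, F c = F 0 + F 1 :=
  Fin.sum_univ_two F

theorem bit_cases (c : Bit) : c = 0 ∨ c = 1 := by revert c; decide

theorem sum_bern (x : ℝ) : ∑ c, bern x c = 1 := by simp [sum_bit, bern]

theorem sum_nextProb (x y : ℝ) (a b : Bit) : ∑ c, nextProb x y a b c = 1 := by
  unfold nextProb; split_ifs <;> exact sum_bern _

theorem pad_cons {N : ℕ} (c : Bit) (s : Fin N → Bit) :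
    pad (Fin.cons c s : Fin (N + 1) → Bit) = consSeq c (pad s) := by
  funext k
  cases k with
  | zero => simp [pad, consSeq]
  | succ k =>
    by_cases h : k < N
    · simp only [pad, consSeq, h, dif_pos, Nat.succ_lt_succ_iff]
      exact Fin.cons_succ (α := fun _ => Bit) c s ⟨k, h⟩
    · simp [pad, consSeq, h]

theorem sum_fin_cons {M : Type*} [AddCommMonoid M] {N : ℕ} (F : (Fin (N + 1) → Bit) → M) :
    ∑ s, F s = ∑ c, ∑ s : Fin N → Bit, F (Fin.cons c s) := by
  rw [← Fintype.sum_prod_type']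
  exact (Fintype.sum_equiv (Fin.consEquiv (fun _ => Bit)) _ _ (fun _ => rfl)).symm

theorem chainExp_zero (x y : ℝ) (a b : Bit) (F : (ℕ → Bit) → ℝ) :
    chainExp x y a b 0 F = F (fun _ => 0) := by
  simp only [chainExp, Finset.univ_unique, Finset.sum_singleton, List.ofFn_zero, chainWeight,
    one_mul]
  rfl

theorem chainExp_succ (x y : ℝ) (a b : Bit) (N : ℕ) (F : (ℕ → Bit) → ℝ) :
    chainExp x y a b (N + 1) F =
      ∑ c, nextProb x y a b c * chainExp y x b c N (fun s => F (consSeq c s)) := by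
  unfold chainExp
  rw [sum_fin_cons]
  refine Finset.sum_congr rfl fun c _ => ?_
  rw [Finset.mul_sum]
  refine Finset.sum_congr rfl fun s _ => ?_
  rw [pad_cons, List.ofFn_succ]
  simp only [Fin.cons_zero, Fin.cons_succ, chainWeight, mul_assoc]

theorem chainExp_one (x y : ℝ) (a b : Bit) (N : ℕ) : chainExp x y a b N (fun _ => 1) = 1 := by
  induction N generalizing x y a b with
  | zero => simp [chainExp_zero]
  | succ N ih => simp [chainExp_succ, ih, sum_nextProb]

theorem chainExp_mul_left (x y : ℝ) (a b : Bit) (N : ℕ) (r : ℝ) (F : (ℕ → Bit) → ℝ) :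
    chainExp x y a b N (fun s => r * F s) = r * chainExp x y a b N F := by
  simp only [chainExp, Finset.mul_sum]
  exact Finset.sum_congr rfl fun s _ => by ring

theorem chainExp_const (x y : ℝ) (a b : Bit) (N : ℕ) (r : ℝ) :
    chainExp x y a b N (fun _ => r) = r := by
  simpa [chainExp_one] using chainExp_mul_left x y a b N r (fun _ => 1)

theorem chainExp_sum (x y : ℝ) (a b : Bit) (N : ℕ) {ι : Type*} (S : Finset ι)
    (F : ι → (ℕ → Bit) → ℝ) :
    chainExp x y a b N (fun s => ∑ i ∈ S, F i s) = ∑ i ∈ S, chainExp x y a b N (F i) := by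
  simp only [chainExp, Finset.mul_sum]
  exact Finset.sum_comm

/-! ### Dynamics of a driven half-line -/

/-- Evolution of the sites `1, 2, 3, …` from the initial values `s 0, s 1, s 2, …` when the values
of site `0` are prescribed to be `d t`. Site `k` is updated in the step leading to time `t` if
`k + t + f` is even. -/
def halfEvolve (f : ℕ) (d s : ℕ → Bit) : ℕ → ℕ → Bit
  | 0, 0 => d 0
  | 0, k + 1 => s k
  | t + 1, 0 => d (t + 1)
  | t + 1, k + 1 =>
      if Even (k + t + f) then
        chi (halfEvolve f d s t k) (halfEvolve f d s t (k + 1)) (halfEvolve f d s t (k + 2))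
      else halfEvolve f d s t (k + 1)

theorem halfEvolve_zero_right (f : ℕ) (d s : ℕ → Bit) (t : ℕ) : halfEvolve f d s t 0 = d t := by
  cases t <;> simp [halfEvolve]

theorem halfEvolve_succ (f : ℕ) (d s : ℕ → Bit) (t k : ℕ) :
    halfEvolve f d s (t + 1) (k + 1) = if Even (k + t + f) then
        chi (halfEvolve f d s t k) (halfEvolve f d s t (k + 1)) (halfEvolve f d s t (k + 2))
      else halfEvolve f d s t (k + 1) := by
  rw [halfEvolve]

/-- The values of the first site of a driven half-line. -/
def column (f : ℕ) (d s : ℕ → Bit) (t : ℕ) : Bit := halfEvolve f d s t 1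

theorem column_zero (f : ℕ) (d : ℕ → Bit) (a : Bit) (s : ℕ → Bit) :
    column f d (consSeq a s) 0 = a := by
  simp [column, halfEvolve, consSeq]

theorem column_succ_of_odd {f t : ℕ} (h : ¬ Even (t + f)) (d s : ℕ → Bit) :
    column f d s (t + 1) = column f d s t := by
  simp [column, halfEvolve_succ, h]

/-- Seen from the first site, the remaining half-line is driven by the column of that site. -/
theorem halfEvolve_shift {f : ℕ} {d o s : ℕ → Bit} {a : Bit} {T : ℕ}
    (h : ∀ t ≤ T, column f d (consSeq a s) t = o t) :
    ∀ t ≤ T, ∀ k, halfEvolve f d (consSeq a s) t (k + 1) = halfEvolve (f + 1) o s t k := by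
  intro t
  induction t with
  | zero =>
    intro ht k
    cases k with
    | zero => rw [halfEvolve_zero_right]; exact h 0 ht
    | succ k => simp [halfEvolve, consSeq]
  | succ t ih =>
    intro ht k
    cases k with
    | zero => rw [halfEvolve_zero_right]; exact h _ ht
    | succ k =>
      have ih' := ih (by omega)
      rw [halfEvolve_succ, halfEvolve_succ, ih' k, ih' (k + 1), ih' (k + 2)]
      have : k + 1 + t + f = k + t + (f + 1) := by omega
      rw [this]

theorem column_succ_of_even {f : ℕ} {d o s : ℕ → Bit} {a : Bit} {T : ℕ} (hT : Even (T + f))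
    (h : ∀ t ≤ T, column f d (consSeq a s) t = o t) :
    column f d (consSeq a s) (T + 1) = chi (d T) (o T) (column (f + 1) o s T) := by
  unfold column
  rw [halfEvolve_succ, if_pos (by simpa using hT), halfEvolve_zero_right,
    halfEvolve_shift h T le_rfl 0, halfEvolve_shift h T le_rfl 1, halfEvolve_zero_right]

/-- The column `e` of the second site is compatible with the columns `d` and `o` of the sites `0`
and `1` up to time `T`. -/
def Compatible (f : ℕ) (d o : ℕ → Bit) (T : ℕ) (e : ℕ → Bit) : Prop :=
  ∀ t < T, o (t + 1) = if Even (t + f) then chi (d t) (o t) (e t) else o t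

/-- The second column is computed here as if the first site already followed `o`. This is not
circular: the value at time `T + 1` reads columns only up to time `T`, so agreement propagates by
induction. -/
theorem compatible_iff {f : ℕ} {d o s : ℕ → Bit} {T : ℕ} :
    (∀ t ≤ T, column f d (consSeq (o 0) s) t = o t) ↔
      Compatible f d o T (column (f + 1) o s) := by
  induction T with
  | zero =>
    simp [Compatible, column_zero]
  | succ T ih =>
    have key : (∀ t ≤ T, column f d (consSeq (o 0) s) t = o t) →
        (column f d (consSeq (o 0) s) (T + 1) =
          if Even (T + f) then chi (d T) (o T) (column (f + 1) o s T) else o T) := by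
      intro h
      split_ifs with hT
      · exact column_succ_of_even hT h
      · rw [column_succ_of_odd hT, h T le_rfl]
    constructor
    · intro h t ht
      have h' : ∀ t ≤ T, column f d (consSeq (o 0) s) t = o t := fun t ht => h t (by omega)
      rcases Nat.lt_succ_iff_lt_or_eq.1 ht with ht | rfl
      · exact ih.1 h' t ht
      · rw [← key h', h _ le_rfl]
    · intro h t ht
      have h' := ih.2 fun t ht => h t (by omega)
      rcases Nat.le_succ_iff.1 ht with ht | rfl
      · exact h' t ht
      · rw [key h', h _ (by omega)]

/-! ### The time-state of a driven half-line -/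

/-- Expectation over the sites beyond the first one of a half-line, whose rows are labelled as in
`halfEvolve`, with filling probability `x` on the row updated last and `y` on the other row. -/
def bathExp (f : ℕ) (x y : ℝ) (a b : Bit) (N : ℕ) (F : (ℕ → Bit) → ℝ) : ℝ :=
  if Even f then chainExp x y a b N F else chainExp y x a b N F

/-- Removing a site changes the parity of `f` and also exchanges the rows. The two effects cancel,
so `x` and `y` keep their places and the induction over sites yields the same filling `x` at every
level. -/
theorem bathExp_succ (f : ℕ) (x y : ℝ) (a b : Bit) (N : ℕ) (F : (ℕ → Bit) → ℝ) :
    bathExp f x y a b (N + 1) F =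
      ∑ c, (if Even f then nextProb x y a b c else nextProb y x a b c) *
        bathExp (f + 1) x y b c N (fun s => F (consSeq c s)) := by
  by_cases h : Even f
  · have h' : ¬ Even (f + 1) := by simpa [Nat.even_add_one] using h
    simp [bathExp, h, h', chainExp_succ]
  · have h' : Even (f + 1) := by simpa [Nat.even_add_one] using h
    simp [bathExp, h, h', chainExp_succ]

theorem bathExp_sum (f : ℕ) (x y : ℝ) (a b : Bit) (N : ℕ) {ι : Type*} (S : Finset ι)
    (F : ι → (ℕ → Bit) → ℝ) :
    bathExp f x y a b N (fun s => ∑ i ∈ S, F i s) = ∑ i ∈ S, bathExp f x y a b N (F i) := by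
  unfold bathExp; split_ifs <;> exact chainExp_sum ..

theorem bathExp_mul_left (f : ℕ) (x y : ℝ) (a b : Bit) (N : ℕ) (r : ℝ) (F : (ℕ → Bit) → ℝ) :
    bathExp f x y a b N (fun s => r * F s) = r * bathExp f x y a b N F := by
  unfold bathExp; split_ifs <;> exact chainExp_mul_left ..

theorem bathExp_const (f : ℕ) (x y : ℝ) (a b : Bit) (N : ℕ) (r : ℝ) :
    bathExp f x y a b N (fun _ => r) = r := by
  unfold bathExp; split_ifs <;> exact chainExp_const ..

open Classical in
/-- The indicator of a proposition. -/
noncomputable def ind (p : Prop) : ℝ := if p then 1 else 0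

theorem ind_of_true {p : Prop} (h : p) : ind p = 1 := if_pos h

theorem ind_of_false {p : Prop} (h : ¬ p) : ind p = 0 := if_neg h

theorem ind_and (p q : Prop) : ind (p ∧ q) = ind p * ind q := by
  by_cases hp : p <;> by_cases hq : q <;> simp [ind, hp, hq]

theorem ind_congr {p q : Prop} (h : p ↔ q) : ind p = ind q := by rw [propext h]

theorem ind_mul_congr {p : Prop} {r r' : ℝ} (h : p → r = r') : ind p * r = ind p * r' := by
  by_cases hp : p
  · rw [h hp]
  · simp [ind_of_false hp]

theorem ind_eq_sum (F : Bit → Prop) (k : Bit) : ind (F k) = ∑ c, ind (F c) * ind (k = c) := by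
  rw [Finset.sum_eq_single k]
  · simp [ind]
  · intro b _ hb
    simp [ind, hb.symm]
  · simp

/-- Splitting with respect to an initial piece of a sequence. -/
theorem eq_sum_ind {T : ℕ} (Φ : (ℕ → Bit) → ℝ)
    (hΦ : ∀ c c' : ℕ → Bit, (∀ t ≤ T, c t = c' t) → Φ c = Φ c') (u : ℕ → Bit) :
    Φ u = ∑ c : Fin (T + 1) → Bit, Φ (pad c) * ind (∀ t ≤ T, u t = pad c t) := by
  have hpad : ∀ (c : Fin (T + 1) → Bit) (t : ℕ) (ht : t ≤ T), pad c t = c ⟨t, by omega⟩ := by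
    intro c t ht
    simp [pad, Nat.lt_succ_of_le ht]
  rw [Finset.sum_eq_single (fun i : Fin (T + 1) => u i)]
  · rw [ind_of_true, mul_one]
    · exact hΦ _ _ fun t ht => by rw [hpad _ t ht]
    · intro t ht
      rw [hpad _ t ht]
  · intro c _ hc
    rw [ind_of_false, mul_zero]
    intro h
    apply hc
    funext i
    rw [h i (by omega), hpad c i (by omega)]
  · simp

theorem bathExp_congr {f : ℕ} {x y : ℝ} {a b : Bit} {N : ℕ} {F G : (ℕ → Bit) → ℝ}
    (h : ∀ s, F s = G s) : bathExp f x y a b N F = bathExp f x y a b N G := by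
  rw [funext h]

/-- Conditional law of the next value of the first site, given its column `o` up to time `T`. -/
def FixedColumnLaw (x y : ℝ) (N : ℕ) : Prop :=
  ∀ (f : ℕ) (d o : ℕ → Bit) (T : ℕ) (h : Bit), ¬ Even (T + f) → T + 2 ≤ N →
    (o T = 1 → d (T + 1) = 1 + d T) → d T = d (T - 1) →
    bathExp f x y (d 0) (o 0) N (fun s =>
      ind (∀ t ≤ T, column f d (consSeq (o 0) s) t = o t) *
        ind (column f d (consSeq (o 0) s) (T + 2) = h)) =
    condProb x (d T) (o T) (d (T + 1)) h * bathExp f x y (d 0) (o 0) N (fun s =>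
      ind (∀ t ≤ T, column f d (consSeq (o 0) s) t = o t))

/-- Conditional law of the next value of the first site, tested against functions `Φ` of its column
up to time `T`. -/
def ColumnLaw (x y : ℝ) (N : ℕ) : Prop :=
  ∀ (f : ℕ) (d : ℕ → Bit) (a : Bit) (T : ℕ) (h : Bit) (Φ : (ℕ → Bit) → ℝ), ¬ Even (T + f) →
    T + 2 ≤ N → (∀ c c' : ℕ → Bit, (∀ t ≤ T, c t = c' t) → Φ c = Φ c') →
    (∀ c, c 0 = a → Φ c ≠ 0 → (c T = 1 → d (T + 1) = 1 + d T) ∧ d T = d (T - 1)) →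
    bathExp f x y (d 0) a N (fun s =>
      Φ (column f d (consSeq a s)) * ind (column f d (consSeq a s) (T + 2) = h)) =
    bathExp f x y (d 0) a N (fun s =>
      Φ (column f d (consSeq a s)) *
        condProb x (d T) (column f d (consSeq a s) T) (d (T + 1)) h)

/-- Follows by decomposing `Φ` over all columns up to time `T`. Test functions are needed because
prescribing the first column only restricts the second one to a set of compatible columns. -/
theorem FixedColumnLaw.columnLaw {x y : ℝ} {N : ℕ} (H : FixedColumnLaw x y N) :
    ColumnLaw x y N := by
  intro f d a T h Φ hf hN hΦ hleg
  have e1 : ∀ s, Φ (column f d (consSeq a s)) * ind (column f d (consSeq a s) (T + 2) = h) =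
      ∑ c : Fin (T + 1) → Bit, Φ (pad c) *
        (ind (∀ t ≤ T, column f d (consSeq a s) t = pad c t) *
          ind (column f d (consSeq a s) (T + 2) = h)) := by
    intro s
    rw [eq_sum_ind Φ hΦ, Finset.sum_mul]
    exact Finset.sum_congr rfl fun c _ => by ring
  have e2 : ∀ s, Φ (column f d (consSeq a s)) *
        condProb x (d T) (column f d (consSeq a s) T) (d (T + 1)) h =
      ∑ c : Fin (T + 1) → Bit, Φ (pad c) * condProb x (d T) (pad c T) (d (T + 1)) h *
        ind (∀ t ≤ T, column f d (consSeq a s) t = pad c t) := by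
    intro s
    refine eq_sum_ind (fun c => Φ c * condProb x (d T) (c T) (d (T + 1)) h) ?_ _
    intro c c' hc
    simp only [hΦ c c' hc, hc T le_rfl]
  rw [bathExp_congr e1, bathExp_congr e2, bathExp_sum, bathExp_sum]
  refine Finset.sum_congr rfl fun c _ => ?_
  rw [bathExp_mul_left, bathExp_mul_left]
  by_cases ha : pad c 0 = a
  · by_cases hc : Φ (pad c) = 0
    · simp [hc]
    · obtain ⟨h1, h2⟩ := hleg (pad c) ha hc
      have := H f d (pad c) T h hf hN h1 h2
      rw [ha] at this
      rw [this, mul_assoc]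
  · have hz : ∀ s, ind (∀ t ≤ T, column f d (consSeq a s) t = pad c t) = 0 := by
      intro s
      refine ind_of_false fun hh => ha ?_
      rw [← hh 0 (Nat.zero_le _), column_zero]
    simp only [hz, zero_mul, bathExp_const, mul_zero]

/-! ### Local identities and the induction on the number of sites -/

/-- After an empty site the update is `c + r`. If `c = 0`, then `r` is 1 with probability `x`; if `c
= 1`, then `r` is 0 with probability `x`. Either way the sum is 1 with probability `x`. -/
theorem bath_two_sites (x y : ℝ) (b k : Bit) (a : Bit) (hb : b = 0) :
    ∑ c, nextProb y x a b c * ∑ r, nextProb x y b c r * ind (chi b c r = k) = bern x k := by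
  subst hb
  have e : ∀ c r : Bit, chi 0 c r = c + r := by decide
  have h1 : (1 : Bit) + 1 = 0 := by decide
  rcases bit_cases k with rfl | rfl <;>
    simp [sum_bit, nextProb, bern, ind, e, h1] <;> ring

/-- The case `T = 0` of the column law: there is no history yet, and the spatial transition
probabilities of the stationary state alone must produce `condProb`. -/
theorem bath_first_step (x y : ℝ) (a b c k : Bit) (hl : b = 1 → c = 1 + a) :
    ∑ e, nextProb y x a b e * ∑ r, nextProb x y b e r * ind (chi c b (chi b e r) = k) =
      condProb x a b c k := by
  have h1 : (1 : Bit) + 1 = 0 := by decide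
  rcases bit_cases a with rfl | rfl <;> rcases bit_cases b with rfl | rfl <;>
  rcases bit_cases c with rfl | rfl <;> rcases bit_cases k with rfl | rfl <;>
    first
      | exact absurd (hl rfl) (by decide)
      | (simp [sum_bit, nextProb, bern, ind, chi, condProb, Forbidden, h1] <;> ring)

/-- If the first site is empty after a step in which it was updated, then the present value of
the second site is independent of the column of the first one. -/
theorem bath_second_site {x y : ℝ} {N : ℕ} (H : ColumnLaw x y N) (f : ℕ) (d o : ℕ → Bit)
    (T : ℕ) (h : Bit) (hf : Even (T + f)) (hN : T ≤ N) (h0 : o T = 0) :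
    bathExp f x y (d 0) (o 0) (N + 1) (fun s =>
      ind (Compatible f d o T (column (f + 1) o s)) * ind (column (f + 1) o s T = h)) =
    bern x h * bathExp f x y (d 0) (o 0) (N + 1) (fun s =>
      ind (Compatible f d o T (column (f + 1) o s))) := by
  match T, hf, hN, h0 with
  | 0, hf, hN, h0 =>
    have hf' : Even f := by simpa using hf
    have hC : ∀ e, ind (Compatible f d o 0 e) = 1 := fun e => ind_of_true (by simp [Compatible])
    simp only [hC, one_mul, bathExp_const, mul_one]
    rw [bathExp_succ]
    simp only [column_zero, bathExp_const, if_pos hf', h0]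
    rcases bit_cases h with rfl | rfl <;> simp [nextProb, ind]
  | 1, hf, hN, h0 =>
    have hf' : ¬ Even f := by
      rw [add_comm, Nat.even_add_one] at hf; exact hf
    have hf2 : Even (f + 1) := by rwa [Nat.even_add_one]
    have hC : ∀ e, ind (Compatible f d o 1 e) = ind (o 1 = o 0) :=
      fun e => ind_congr (by simp [Compatible, hf'])
    simp only [hC]
    rw [bathExp_mul_left, bathExp_const, mul_comm (bern x h)]
    refine ind_mul_congr fun h10 => ?_
    obtain ⟨N, rfl⟩ : ∃ M, N = M + 1 := ⟨N - 1, by omega⟩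
    have hcol : ∀ c r s, column (f + 1) o (consSeq c (consSeq r s)) 1 = chi (o 0) c r := by
      intro c r s
      rw [column_succ_of_even (T := 0) (o := fun _ => c) (by simpa using hf2)]
      · rw [column_zero]
      · intro t ht
        obtain rfl : t = 0 := by omega
        rw [column_zero]
    rw [bathExp_succ]
    simp only [bathExp_succ, hcol, bathExp_const, if_neg hf', if_pos hf2]
    exact bath_two_sites x y (o 0) h (d 0) (by rw [← h10, h0])
  | T + 2, hf, hN, h0 =>
    have hf' : Even (T + f) := by
      have : T + 2 + f = T + f + 2 := by omega
      rw [this] at hf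
      simpa [Nat.even_add] using hf
    have hodd : ¬ Even (T + 1 + f) := by
      have : T + 1 + f = T + f + 1 := by omega
      rw [this, Nat.even_add_one]; simpa using hf'
    rw [bathExp_succ, bathExp_succ, Finset.mul_sum]
    refine Finset.sum_congr rfl fun c _ => ?_
    rw [mul_left_comm]
    congr 1
    have hC : ∀ e, Compatible f d o (T + 2) e →
        o (T + 1) = chi (d T) (o T) (e T) ∧ o (T + 1) = 0 := by
      intro e he
      have h1 := he T (by omega)
      have h2 := he (T + 1) (by omega)
      rw [if_pos hf'] at h1
      rw [if_neg hodd] at h2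
      exact ⟨h1, by rw [← h2, h0]⟩
    -- As `o (T + 1) = 0`, the triple formed by `o T`, the second site at time `T` and `o (T + 1)`
    -- is never 010, so `condProb` reduces to `bern x`.
    have hleg : ∀ a b e : Bit, 0 = chi a b e → e = 1 → b = 1 := by decide
    have key := H (f + 1) o c T h (fun e => ind (Compatible f d o (T + 2) e))
      (by rwa [show T + (f + 1) = T + 1 + f by omega]) hN ?_ ?_
    · rw [key, ← bathExp_mul_left]
      refine bathExp_congr fun s => ?_
      rw [mul_comm (bern x h)]
      refine ind_mul_congr fun hc => ?_
      obtain ⟨h1, h2⟩ := hC _ hc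
      rw [h2]
      rw [h2] at h1
      have := hleg _ _ _ h1
      rcases bit_cases (column (f + 1) o (consSeq c s) T) with h3 | h3
      · simp [condProb, Forbidden, h3, bern]
      · simp [condProb, Forbidden, h3, bern, this h3]
    -- The last condition, at `t = T + 1`, has the parity at which the first site is frozen, so
    -- compatibility up to `T + 2` reads `e` only up to time `T`.
    · intro e e' he
      refine ind_congr (forall₂_congr fun t ht => ?_)
      by_cases htf : Even (t + f)
      · have : t ≤ T := by
          by_contra hlt
          obtain rfl : t = T + 1 := by omega
          exact hodd htf
        rw [he t this]
      · simp [htf]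
    · intro e _ he
      have he : Compatible f d o (T + 2) e := by
        by_contra hne
        exact he (ind_of_false hne)
      obtain ⟨h1, h2⟩ := hC _ he
      refine ⟨fun h3 => ?_, ?_⟩
      · rw [h2] at h1 ⊢
        rw [hleg _ _ _ h1 h3]; decide
      · cases T with
        | zero => rfl
        | succ T =>
          have := he T (by omega)
          rw [if_neg] at this
          · simpa using this
          · rw [show T + 1 + f = T + f + 1 by omega, Nat.even_add_one] at hf'
            exact hf'

theorem column_two_steps {f : ℕ} {d o s : ℕ → Bit} {a : Bit} {T : ℕ} (hT : ¬ Even (T + f))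
    (h : ∀ t ≤ T, column f d (consSeq a s) t = o t) :
    column f d (consSeq a s) (T + 2) = chi (d (T + 1)) (o T) (column (f + 1) o s (T + 1)) := by
  have hT' : Even (T + f + 1) := by rwa [Nat.even_add_one]
  have sh := halfEvolve_shift h T le_rfl
  unfold column
  rw [halfEvolve_succ, if_pos (by rwa [show 0 + (T + 1) + f = T + f + 1 by omega]),
    halfEvolve_zero_right, halfEvolve_succ, halfEvolve_succ, halfEvolve_succ _ _ _ T 0,
    if_neg (by simpa using hT), if_pos (by rwa [show 0 + 1 + T + f = T + f + 1 by omega]),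
    if_pos (by rwa [show 0 + T + (f + 1) = T + f + 1 by omega])]
  rw [sh 0, sh (0 + 1), sh (0 + 2), halfEvolve_zero_right]

/-- If `c = 1`, then `chi 1 b r = 1 + b` ignores `r`; if `b = c = 0`, the update is `r` itself, of
law `bern x`. The relation `hb` excludes forbidden triples `a, e, b`. Hence `e` drops out, except
when `b = 1` and `c = 0`. -/
theorem condProb_step (x : ℝ) (a b c : Bit) (d e k : Bit) (hb : b = chi d a e)
    (hl : b = 1 → c = 1 + d) (hcase : ¬ (b = 1 ∧ c = 0)) :
    ∑ r, ind (chi c b r = k) * condProb x a e b r = condProb x d b c k := by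
  have h1 : (1 : Bit) + 1 = 0 := by decide
  subst hb
  rcases bit_cases a with rfl | rfl <;> rcases bit_cases d with rfl | rfl <;>
  rcases bit_cases c with rfl | rfl <;> rcases bit_cases k with rfl | rfl <;>
  rcases bit_cases e with rfl | rfl <;>
    first
      | exact absurd (hl (by decide)) (by decide)
      | exact absurd ⟨by decide, rfl⟩ hcase
      | (simp [sum_bit, ind, chi, condProb, Forbidden, h1])

/-- The exceptional case: `r` is forced to be `1 + e`, and `chi 0 1 r = 1 + r` gives back `e`. -/
theorem condProb_step_deterministic (x : ℝ) (e k : Bit) :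
    ∑ r, ind (chi 0 1 r = k) * condProb x 0 e 1 r = ind (e = k) := by
  have h1 : (1 : Bit) + 1 = 0 := by decide
  rcases bit_cases k with rfl | rfl <;> rcases bit_cases e with rfl | rfl <;>
    simp [sum_bit, ind, chi, condProb, Forbidden, h1]

/-- The next value of the first site is `chi` of the driver, its own value and the new value of the
second site. The last one has the law given by `H`, with `o` as driver and compatibility as test
function. -/
theorem fixedColumnLaw_succ {x y : ℝ} {N : ℕ} (H : ColumnLaw x y N) :
    FixedColumnLaw x y (N + 1) := by
  intro f d o T h hf hN hleg hd
  have hL : ∀ s, ind (∀ t ≤ T, column f d (consSeq (o 0) s) t = o t) *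
        ind (column f d (consSeq (o 0) s) (T + 2) = h) =
      ind (Compatible f d o T (column (f + 1) o s)) *
        ind (chi (d (T + 1)) (o T) (column (f + 1) o s (T + 1)) = h) := by
    intro s
    rw [← ind_congr compatible_iff]
    refine ind_mul_congr fun hc => ?_
    rw [column_two_steps hf hc]
  rw [bathExp_congr hL, bathExp_congr fun s => ind_congr compatible_iff]
  obtain ⟨N, rfl⟩ : ∃ M, N = M + 1 := ⟨N - 1, by omega⟩
  cases T with
  | zero =>
    have hf' : ¬ Even f := by simpa using hf
    have hf2 : Even (f + 1) := by rwa [Nat.even_add_one]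
    have hC : ∀ e, ind (Compatible f d o 0 e) = 1 := fun e => ind_of_true (by simp [Compatible])
    simp only [hC, one_mul, bathExp_const, mul_one]
    have hcol : ∀ c r s, column (f + 1) o (consSeq c (consSeq r s)) (0 + 1) = chi (o 0) c r := by
      intro c r s
      rw [column_succ_of_even (T := 0) (o := fun _ => c) (by simpa using hf2)]
      · rw [column_zero]
      · intro t ht
        obtain rfl : t = 0 := by omega
        rw [column_zero]
    rw [bathExp_succ]
    simp only [bathExp_succ, hcol, bathExp_const, if_neg hf', if_pos hf2]
    exact bath_first_step x y (d 0) (o 0) (d (0 + 1)) h hleg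
  | succ T =>
    have hfe : Even (T + f) := by
      rw [show T + 1 + f = T + f + 1 by omega, Nat.even_add_one] at hf
      exact not_not.1 hf
    have hCT : ∀ e, Compatible f d o (T + 1) e → o (T + 1) = chi (d T) (o T) (e T) := by
      intro e he
      have := he T (by omega)
      rwa [if_pos hfe] at this
    have hstep : bathExp f x y (d 0) (o 0) (N + 1 + 1) (fun s =>
          ind (Compatible f d o (T + 1) (column (f + 1) o s)) *
            ind (chi (d (T + 1 + 1)) (o (T + 1)) (column (f + 1) o s (T + 1 + 1)) = h)) =
        bathExp f x y (d 0) (o 0) (N + 1 + 1) (fun s =>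
          ind (Compatible f d o (T + 1) (column (f + 1) o s)) *
            ∑ r, ind (chi (d (T + 1 + 1)) (o (T + 1)) r = h) *
              condProb x (o T) (column (f + 1) o s T) (o (T + 1)) r) := by
      rw [bathExp_succ, bathExp_succ]
      refine Finset.sum_congr rfl fun c _ => ?_
      congr 1
      have e1 : ∀ s, ind (Compatible f d o (T + 1) (column (f + 1) o (consSeq c s))) *
            ind (chi (d (T + 1 + 1)) (o (T + 1)) (column (f + 1) o (consSeq c s) (T + 1 + 1)) = h)
          = ∑ r, ind (chi (d (T + 1 + 1)) (o (T + 1)) r = h) *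
            (ind (Compatible f d o (T + 1) (column (f + 1) o (consSeq c s))) *
              ind (column (f + 1) o (consSeq c s) (T + 2) = r)) := by
        intro s
        rw [ind_eq_sum (fun k => chi (d (T + 1 + 1)) (o (T + 1)) k = h), Finset.mul_sum]
        exact Finset.sum_congr rfl fun r _ => by ring
      have e2 : ∀ s, ind (Compatible f d o (T + 1) (column (f + 1) o (consSeq c s))) *
            ∑ r, ind (chi (d (T + 1 + 1)) (o (T + 1)) r = h) *
              condProb x (o T) (column (f + 1) o (consSeq c s) T) (o (T + 1)) r
          = ∑ r, ind (chi (d (T + 1 + 1)) (o (T + 1)) r = h) *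
            (ind (Compatible f d o (T + 1) (column (f + 1) o (consSeq c s))) *
              condProb x (o T) (column (f + 1) o (consSeq c s) T) (o (T + 1)) r) := by
        intro s
        rw [Finset.mul_sum]
        exact Finset.sum_congr rfl fun r _ => by ring
      rw [bathExp_congr e1, bathExp_congr e2, bathExp_sum, bathExp_sum]
      refine Finset.sum_congr rfl fun r _ => ?_
      rw [bathExp_mul_left, bathExp_mul_left]
      congr 1
      refine H (f + 1) o c T r (fun e => ind (Compatible f d o (T + 1) e))
        (by rwa [show T + (f + 1) = T + 1 + f by omega]) (by omega) ?_ ?_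
      · intro e e' he
        refine ind_congr (forall₂_congr fun t ht => ?_)
        rw [he t (by omega)]
      · intro e _ he
        have he : Compatible f d o (T + 1) e := by
          by_contra hne
          exact he (ind_of_false hne)
        refine ⟨fun h3 => ?_, ?_⟩
        · have := hCT e he
          rw [h3] at this
          rw [this]
          generalize o T = b
          generalize d T = a
          revert a b; decide
        · cases T with
          | zero => rfl
          | succ T =>
            have := he T (by omega)
            rw [if_neg] at this
            · simpa using this
            · rw [show T + 1 + f = T + f + 1 by omega, Nat.even_add_one] at hfe
              exact hfe
    rw [hstep]
    -- In this case legality gives `d (T + 1) = d T = 1`, and `o (T + 1) = 1` then forces `o T = 0`.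
    -- Since `chi 1 0 e = 1` for both `e`, the last compatibility condition does not restrict the
    -- second site at time `T`, so `bath_second_site` applies to the value that is copied.
    by_cases hcase : o (T + 1) = 1 ∧ d (T + 1 + 1) = 0
    · obtain ⟨hb, hc⟩ := hcase
      have hd1 : d (T + 1) = 1 := by
        have := hleg hb
        rw [hc] at this
        generalize d (T + 1) = u at this
        revert u; decide
      have hd0 : d T = 1 := by rw [← hd1, hd]; rfl
      have hb0 : ∀ e, Compatible f d o (T + 1) e → o T = 0 := by
        intro e he
        have := hCT e he
        rw [hb, hd0] at this
        generalize o T = u at this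
        generalize e T = v at this
        revert u v; decide
      by_cases ho : o T = 0
      · have hco : ∀ e, ind (Compatible f d o (T + 1) e) = ind (Compatible f d o T e) := by
          intro e
          refine ind_congr ⟨fun hh t ht => hh t (by omega), fun hh t ht => ?_⟩
          rcases Nat.lt_succ_iff_lt_or_eq.1 ht with ht | rfl
          · exact hh t ht
          · rw [if_pos hfe, hb, hd0, ho]
            generalize e t = u
            revert u; decide
        simp only [hb, hc, ho, condProb_step_deterministic, hco, hd1]
        rw [bath_second_site H f d o T h hfe (by omega) ho]
        congr 1
      · have hz : ∀ e, ind (Compatible f d o (T + 1) e) = 0 :=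
          fun e => ind_of_false fun he => ho (hb0 e he)
        simp only [hz, zero_mul, bathExp_const, mul_zero]
    · rw [← bathExp_mul_left]
      refine bathExp_congr fun s => ?_
      rw [mul_comm (condProb _ _ _ _ _)]
      refine ind_mul_congr fun hc => ?_
      rw [hd]
      refine condProb_step x _ _ _ _ _ h (hCT _ hc) ?_ hcase
      intro hb
      rw [hleg hb, hd]

theorem columnLaw (x y : ℝ) (N : ℕ) : ColumnLaw x y N := by
  induction N with
  | zero => intro f d a T h Φ _ hN; omega
  | succ N ih => exact (fixedColumnLaw_succ ih).columnLaw

/-! ### The stationary state in terms of the filling probabilities -/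

/-- The matrices `W_s`, rescaled by diagonal matrices so that `P_0 + P_1` is stochastic; `x` and `y`
are the filling probabilities of left- and right-movers. -/
def P (x y : ℝ) (s : Bit) : Matrix (Fin 3) (Fin 3) ℝ :=
  if s = 0 then !![1 - x, 0, 0; x, 0, 0; 1 - y, 0, 0] else !![0, x, 0; 0, 0, 1 - x; 0, 0, y]

/-- The alternating product `P_{s₁} P'_{s₂} P_{s₃} ⋯`. -/
def wordP (x y : ℝ) : List Bit → Matrix (Fin 3) (Fin 3) ℝ
  | [] => 1
  | s :: w => P x y s * wordP y x w

/-- The stationary row vector. -/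
noncomputable def statRow (x y : ℝ) : Fin 3 → ℝ := (1 / (1 + x + y)) • ![1, y, x]

/-- Stationary probability of a word. -/
noncomputable def statProb (x y : ℝ) (w : List Bit) : ℝ :=
  statRow x y ⬝ᵥ (wordP x y w *ᵥ vecR)

theorem wordP_append (x y : ℝ) (u v : List Bit) :
    wordP x y (u ++ v) =
      wordP x y u * (if Even u.length then wordP x y v else wordP y x v) := by
  induction u generalizing x y with
  | nil => simp [wordP]
  | cons c u ih =>
    rw [List.cons_append, wordP, ih, wordP, mul_assoc, List.length_cons]
    by_cases h : Even u.length <;> simp [Nat.even_add_one, h]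

/-- The product of two consecutive matrices has rank at most one, so appending a letter only
rescales the resulting vector: the chain has memory two. -/
theorem P_mulVec_nextProb (x y : ℝ) (a b c : Bit) :
    P x y a *ᵥ (P y x b *ᵥ (P x y c *ᵥ vecR)) =
      nextProb x y a b c • (P x y a *ᵥ (P y x b *ᵥ vecR)) := by
  rcases bit_cases a with rfl | rfl <;> rcases bit_cases b with rfl | rfl <;>
  rcases bit_cases c with rfl | rfl <;> funext i <;> fin_cases i <;>
    simp [P, vecR, nextProb, bern, Matrix.mulVec, dotProduct, Fin.sum_univ_three] <;>
    first | ring1 | (left; ring1)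

theorem wordP_mulVec_chainWeight (x y : ℝ) (a b : Bit) (w : List Bit) :
    P x y a *ᵥ (P y x b *ᵥ (wordP x y w *ᵥ vecR)) =
      chainWeight x y a b w • (P x y a *ᵥ (P y x b *ᵥ vecR)) := by
  induction w generalizing x y a b with
  | nil => simp [wordP, chainWeight]
  | cons c w ih =>
    rw [wordP, ← Matrix.mulVec_mulVec, ih, Matrix.mulVec_smul, P_mulVec_nextProb, smul_smul,
      chainWeight, mul_comm]

/-- The same transition function governs the reading from right to left, because reflection combined
with exchange of the rows preserves the state. -/
theorem P_vecMul_nextProb {x y : ℝ} (a b c : Bit) :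
    statRow y x ᵥ* P y x c ᵥ* P x y b ᵥ* P y x a =
      nextProb x y a b c • (statRow x y ᵥ* P x y b ᵥ* P y x a) := by
  simp only [statRow, Matrix.smul_vecMul, add_right_comm 1 y x]
  rw [smul_comm]
  congr 1
  rcases bit_cases a with rfl | rfl <;> rcases bit_cases b with rfl | rfl <;>
  rcases bit_cases c with rfl | rfl <;> funext i <;> fin_cases i <;>
    simp [P, nextProb, bern, Matrix.vecMul, dotProduct, Fin.sum_univ_three] <;> ring

theorem wordP_vecMul_chainWeight (x y : ℝ) (a b : Bit) (w : List Bit) :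
    (if Even w.length then statRow x y ᵥ* wordP x y w.reverse
      else statRow y x ᵥ* wordP y x w.reverse) ᵥ* P x y b ᵥ* P y x a =
    chainWeight x y a b w • (statRow x y ᵥ* P x y b ᵥ* P y x a) := by
  induction w generalizing x y a b with
  | nil => simp [wordP, chainWeight]
  | cons c w ih =>
    have h := congrArg (· ᵥ* P y x a) (ih y x b c)
    simp only [Matrix.smul_vecMul, P_vecMul_nextProb, smul_smul] at h
    rw [chainWeight, mul_comm (nextProb _ _ _ _ _), ← h]
    congr 2
    by_cases hw : Even w.length <;>
      simp [Nat.even_add_one, hw, wordP_append, wordP, Matrix.vecMul_vecMul]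

/-- Conditional independence: given an adjacent pair, the words on its two sides have independent
chain weights. -/
theorem statProb_chain (x y : ℝ) (u v : List Bit) (a b : Bit) :
    (if Even u.length then statProb x y (u.reverse ++ a :: b :: v)
      else statProb y x (u.reverse ++ a :: b :: v)) =
    statProb x y [a, b] * chainWeight x y a b v * chainWeight x y b a u := by
  have h1 := congrArg (· ⬝ᵥ (wordP x y v *ᵥ vecR)) (wordP_vecMul_chainWeight x y b a u)
  have h2 := congrArg (statRow x y ⬝ᵥ ·) (wordP_mulVec_chainWeight x y a b v)
  simp only [Matrix.smul_vecMul, smul_dotProduct, dotProduct_smul,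
    Matrix.dotProduct_mulVec] at h1 h2
  have h3 : statProb x y [a, b] = statRow x y ᵥ* P x y a ᵥ* P y x b ⬝ᵥ vecR := by
    simp [statProb, wordP, Matrix.dotProduct_mulVec, Matrix.vecMul_vecMul]
  rw [h3, mul_comm _ (chainWeight x y a b v), mul_comm _ (chainWeight x y b a u), ← smul_eq_mul,
    ← smul_eq_mul, ← h2, ← h1]
  by_cases h : Even u.length <;>
    simp [h, statProb, wordP_append, wordP, Matrix.dotProduct_mulVec, Matrix.vecMul_vecMul,
      mul_assoc]

/-! ### Sums over windows -/

theorem sum_ofFn_append {M : Type*} [AddCommMonoid M] (m n : ℕ) (H : List Bit → M) :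
    ∑ s : Fin (m + n) → Bit, H (List.ofFn s) =
      ∑ u : Fin m → Bit, ∑ v : Fin n → Bit, H (List.ofFn u ++ List.ofFn v) := by
  rw [← Fintype.sum_prod_type']
  refine (Fintype.sum_equiv (Fin.appendEquiv m n) _ _ fun p => ?_).symm
  rw [← List.ofFn_fin_append]
  rfl

theorem sum_ofFn_cons {M : Type*} [AddCommMonoid M] (n : ℕ) (H : List Bit → M) :
    ∑ s : Fin (n + 1) → Bit, H (List.ofFn s) =
      ∑ c, ∑ v : Fin n → Bit, H (c :: List.ofFn v) := by
  rw [sum_fin_cons]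
  simp only [List.ofFn_cons]

theorem sum_ofFn_reverse {M : Type*} [AddCommMonoid M] (n : ℕ) (H : List Bit → M) :
    ∑ s : Fin n → Bit, H (List.ofFn s) = ∑ s : Fin n → Bit, H (List.ofFn s).reverse := by
  refine Fintype.sum_equiv (Equiv.arrowCongr Fin.revPerm (Equiv.refl _)) _ _ fun s => ?_
  congr 1
  apply List.ext_getElem
  · simp
  · intro i h1 h2
    simp at h1
    simp [Fin.revPerm, Fin.rev]
    congr 2; omega

/-- The configuration on `-n, -n + 1, …` given by a list. -/
def extendList (n : ℕ) (w : List Bit) (x : ℤ) : Bit :=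
  if -(n : ℤ) ≤ x then w.getD (x + n).toNat 0 else 0

theorem extend_eq_extendList (n : ℕ) (s : Fin (2 * n + 1) → Bit) :
    extend n s = extendList n (List.ofFn s) := by
  funext x
  unfold extend extendList
  by_cases h1 : -(n : ℤ) ≤ x
  · by_cases h2 : x ≤ n
    · rw [dif_pos ⟨h1, h2⟩, if_pos h1, List.getD_eq_getElem _ _ (by simp; omega),
        List.getElem_ofFn]
    · rw [dif_neg (fun h => h2 h.2), if_pos h1, List.getD_eq_default _ _ (by simp; omega)]
  · rw [dif_neg (fun h => h1 h.1), if_neg h1]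

theorem getD_ofFn {N : ℕ} (s : Fin N → Bit) (k : ℕ) : (List.ofFn s).getD k 0 = pad s k := by
  unfold pad
  split_ifs with h
  · rw [List.getD_eq_getElem _ _ (by simpa using h)]; simp
  · rw [List.getD_eq_default _ _ (by simpa using h)]

theorem extendList_nonneg {N : ℕ} (u : Fin N → Bit) (v : List Bit) (k : ℕ) :
    extendList N ((List.ofFn u).reverse ++ v) k = v.getD k 0 := by
  unfold extendList
  rw [if_pos (by omega), List.getD_append_right _ _ _ _ (by simp; omega), List.length_reverse,
    List.length_ofFn, show ((k : ℤ) + N).toNat - N = k by omega]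

theorem extendList_neg {N : ℕ} (u : Fin N → Bit) (v : List Bit) (k : ℕ) :
    extendList N ((List.ofFn u).reverse ++ v) (-(k : ℤ) - 1) = pad u k := by
  unfold extendList pad
  by_cases h : k < N
  · rw [if_pos (by omega), dif_pos h, List.getD_append _ _ _ _ (by simp; omega),
      List.getD_eq_getElem _ _ (by simp; omega)]
    simp
    congr 1
    ext
    simp
    omega
  · rw [if_neg (by omega), dif_neg h]

/-- A sum over a window, weighted with stationary probabilities, as a sum over the two half-lines
to the left of site `0` and to the right of site `1`. -/
theorem window_sum (x y : ℝ) (k : ℕ) (F : (ℤ → Bit) → ℝ) :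
    ∑ s : Fin (2 * (k + 1) + 1) → Bit,
      (if Even (k + 1) then statProb x y (List.ofFn s) else statProb y x (List.ofFn s)) *
        F (extend (k + 1) s) =
    ∑ a, ∑ b, statProb x y [a, b] * chainExp x y b a (k + 1) (fun l => chainExp x y a b k
      (fun r => F (fun z => if 0 ≤ z then consSeq a (consSeq b r) z.toNat
        else l (-z - 1).toNat))) := by
  -- The split is asymmetric: `k + 1` sites lie to the left of site 0, but only `k` to the right of
  -- site 1.
  have hlen : 2 * (k + 1) + 1 = (k + 1) + (k + 2) := by omega
  have hcast : ∀ (M M' : ℕ) (h : M = M') (H : List Bit → ℝ),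
      ∑ s : Fin M → Bit, H (List.ofFn s) = ∑ s : Fin M' → Bit, H (List.ofFn s) := by
    intro M M' h H; subst h; rfl
  simp only [extend_eq_extendList]
  refine (hcast _ _ hlen (fun w => (if Even (k + 1) then statProb x y w else statProb y x w) *
    F (extendList (k + 1) w))).trans ?_
  rw [sum_ofFn_append (k + 1) (k + 2) (fun w => (if Even (k + 1) then statProb x y w
      else statProb y x w) * F (extendList (k + 1) w)),
    sum_ofFn_reverse (k + 1) (fun u => ∑ v : Fin (k + 2) → Bit,
      (if Even (k + 1) then statProb x y (u ++ List.ofFn v)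
        else statProb y x (u ++ List.ofFn v)) * F (extendList (k + 1) (u ++ List.ofFn v)))]
  have hv : ∀ H : List Bit → ℝ, ∑ v : Fin (k + 2) → Bit, H (List.ofFn v) =
      ∑ a, ∑ b, ∑ r : Fin k → Bit, H (a :: b :: List.ofFn r) := by
    intro H
    rw [sum_ofFn_cons]
    refine Finset.sum_congr rfl fun a _ => ?_
    rw [sum_ofFn_cons k (fun v => H (a :: v))]
  have e1 : ∀ u : Fin (k + 1) → Bit, ∑ v : Fin (k + 2) → Bit,
      (if Even (k + 1) then statProb x y ((List.ofFn u).reverse ++ List.ofFn v)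
        else statProb y x ((List.ofFn u).reverse ++ List.ofFn v)) *
          F (extendList (k + 1) ((List.ofFn u).reverse ++ List.ofFn v)) =
      ∑ a, ∑ b, ∑ r : Fin k → Bit, statProb x y [a, b] *
        (chainWeight x y b a (List.ofFn u) * (chainWeight x y a b (List.ofFn r) *
          F (fun z => if 0 ≤ z then consSeq a (consSeq b (pad r)) z.toNat
            else pad u (-z - 1).toNat))) := by
    intro u
    rw [hv (fun v => (if Even (k + 1) then statProb x y ((List.ofFn u).reverse ++ v)
        else statProb y x ((List.ofFn u).reverse ++ v)) *
          F (extendList (k + 1) ((List.ofFn u).reverse ++ v)))]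
    refine Finset.sum_congr rfl fun a _ => Finset.sum_congr rfl fun b _ =>
      Finset.sum_congr rfl fun r _ => ?_
    have h := statProb_chain x y (List.ofFn u) (List.ofFn r) a b
    rw [List.length_ofFn] at h
    rw [h]
    have hF : extendList (k + 1) ((List.ofFn u).reverse ++ a :: b :: List.ofFn r) =
        fun z => if 0 ≤ z then consSeq a (consSeq b (pad r)) z.toNat
            else pad u (-z - 1).toNat := by
      funext z
      split_ifs with hz
      · obtain ⟨j, rfl⟩ := Int.eq_ofNat_of_zero_le hz
        rw [extendList_nonneg, Int.toNat_natCast]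
        match j with
        | 0 => rfl
        | 1 => rfl
        | j + 2 => simpa [consSeq] using getD_ofFn r j
      · obtain ⟨j, hj⟩ := Int.eq_ofNat_of_zero_le (show 0 ≤ -z - 1 by omega)
        rw [hj, Int.toNat_natCast, ← extendList_neg u (a :: b :: List.ofFn r)]
        congr 1
        omega
    rw [hF]
    ring
  rw [Finset.sum_congr rfl fun u _ => e1 u, Finset.sum_comm]
  refine Finset.sum_congr rfl fun a _ => ?_
  rw [Finset.sum_comm]
  refine Finset.sum_congr rfl fun b _ => ?_
  simp only [chainExp, Finset.mul_sum]

/-! ### Splitting the dynamics into two driven half-lines -/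

theorem evolve_succ_of_even (s : ℤ → Bit) {t : ℕ} {x : ℤ} (h : Even (x + ((t : ℤ) + 1))) :
    evolve s (t + 1) x = chi (evolve s t (x - 1)) (evolve s t x) (evolve s t (x + 1)) := by
  rw [evolve, if_pos h]

theorem evolve_succ_of_odd (s : ℤ → Bit) {t : ℕ} {x : ℤ} (h : ¬ Even (x + ((t : ℤ) + 1))) :
    evolve s (t + 1) x = evolve s t x := by
  rw [evolve, if_neg h]

theorem chi_comm (a b c : Bit) : chi a b c = chi c b a := by
  unfold chi; ring

/-- Both half-lines are seen along `z ↦ c + ε z` with `ε = ±1`. -/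
theorem evolve_step (s : ℤ → Bit) {ε c : ℤ} {f : ℕ} (hε : ε = 1 ∨ ε = -1) (hf : Even (c + f))
    (t k : ℕ) :
    evolve s (t + 1) (c + ε * (k + 1 : ℕ)) = if Even (k + t + f) then
      chi (evolve s t (c + ε * k)) (evolve s t (c + ε * (k + 1 : ℕ)))
        (evolve s t (c + ε * (k + 2 : ℕ)))
    else evolve s t (c + ε * (k + 1 : ℕ)) := by
  have hpar : Even (c + ε * (k + 1 : ℕ) + ((t : ℤ) + 1)) ↔ Even (k + t + f) := by
    rw [← Int.even_coe_nat]
    rcases hε with rfl | rfl <;> push_cast <;> rw [Int.even_iff] at hf <;>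
      simp only [Int.even_iff] <;> omega
  split_ifs with h
  · rw [evolve_succ_of_even s (hpar.2 h)]
    rcases hε with rfl | rfl
    · congr 2 <;> push_cast <;> ring
    · rw [chi_comm]
      congr 2 <;> push_cast <;> ring
  · rw [evolve_succ_of_odd s (mt hpar.1 h)]

theorem evolve_eq_halfEvolve (s : ℤ → Bit) {ε c : ℤ} {f : ℕ} (hε : ε = 1 ∨ ε = -1)
    (hf : Even (c + f)) {d : ℕ → Bit} {T : ℕ} (h : ∀ t ≤ T, evolve s t c = d t) :
    ∀ t ≤ T, ∀ k : ℕ, evolve s t (c + ε * k) =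
      halfEvolve f d (fun j => s (c + ε * (j + 1 : ℕ))) t k := by
  intro t
  induction t with
  | zero =>
    intro ht k
    cases k with
    | zero => rw [halfEvolve_zero_right, ← h 0 ht]; simp
    | succ k => simp [halfEvolve, evolve]
  | succ t ih =>
    intro ht k
    cases k with
    | zero => rw [halfEvolve_zero_right, ← h _ ht]; simp
    | succ k =>
      have ih' := ih (by omega)
      rw [evolve_step s hε hf, halfEvolve_succ, ih' k, ih' (k + 1), ih' (k + 2)]

theorem evolve_succ_eq_column (s : ℤ → Bit) {ε c : ℤ} {f : ℕ} (hε : ε = 1 ∨ ε = -1)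
    (hf : Even (c + f)) {d : ℕ → Bit} {T : ℕ} (h : ∀ t ≤ T, evolve s t c = d t) :
    evolve s (T + 1) (c + ε) = column f d (fun j => s (c + ε * (j + 1 : ℕ))) (T + 1) := by
  have e := evolve_eq_halfEvolve s hε hf h T le_rfl
  have := evolve_step s hε hf T 0
  rw [column, halfEvolve_succ, ← e 0, ← e (0 + 1), ← e (0 + 2), ← this]
  simp

/-- Two adjacent sites have prescribed columns if and only if the half-lines on either side do,
each one driven by the other site. -/
theorem evolve_columns_iff (s : ℤ → Bit) (d₀ d₁ : ℕ → Bit) (T : ℕ) :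
    (∀ t ≤ T, evolve s t 0 = d₀ t ∧ evolve s t 1 = d₁ t) ↔
      (∀ t ≤ T, column 0 d₀ (fun j => s (j + 1 : ℕ)) t = d₁ t) ∧
        (∀ t ≤ T, column 1 d₁ (fun j => s (-(j : ℤ))) t = d₀ t) := by
  have eR : (fun j : ℕ => s (0 + 1 * (j + 1 : ℕ))) = fun j : ℕ => s (j + 1 : ℕ) := by
    funext j; congr 1; ring
  have eL : (fun j : ℕ => s (1 + -1 * (j + 1 : ℕ))) = fun j : ℕ => s (-(j : ℤ)) := by
    funext j; congr 1; push_cast; ring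
  -- One more step of the full dynamics at either site reads only values up to time `T`, where the
  -- prescribed driver coincides with the true neighbour.
  have key : ∀ T, (∀ t ≤ T, evolve s t 0 = d₀ t ∧ evolve s t 1 = d₁ t) →
      evolve s (T + 1) 1 = column 0 d₀ (fun j => s (j + 1 : ℕ)) (T + 1) ∧
      evolve s (T + 1) 0 = column 1 d₁ (fun j => s (-(j : ℤ))) (T + 1) := by
    intro T h
    have hR := evolve_succ_eq_column s (ε := 1) (c := 0) (f := 0) (Or.inl rfl) (by decide)
      fun t ht => (h t ht).1
    have hL := evolve_succ_eq_column s (ε := -1) (c := 1) (f := 1) (Or.inr rfl) (by decide)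
      fun t ht => (h t ht).2
    rw [eR] at hR
    rw [eL] at hL
    exact ⟨hR, hL⟩
  have h0 : ∀ f d (r : ℕ → Bit), column f d r 0 = r 0 := by
    intro f d r; simp [column, halfEvolve]
  induction T with
  | zero =>
    simp [h0, evolve, and_comm]
  | succ T ih =>
    constructor
    · intro h
      have h' : ∀ t ≤ T, evolve s t 0 = d₀ t ∧ evolve s t 1 = d₁ t := fun t ht => h t (by omega)
      obtain ⟨k1, k2⟩ := key T h'
      obtain ⟨i1, i2⟩ := ih.1 h'
      constructor
      · intro t ht
        rcases Nat.le_succ_iff.1 ht with ht | rfl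
        · exact i1 t ht
        · rw [← k1, (h _ le_rfl).2]
      · intro t ht
        rcases Nat.le_succ_iff.1 ht with ht | rfl
        · exact i2 t ht
        · rw [← k2, (h _ le_rfl).1]
    · rintro ⟨hR, hL⟩ t ht
      have h' := ih.2 ⟨fun t ht => hR t (by omega), fun t ht => hL t (by omega)⟩
      rcases Nat.le_succ_iff.1 ht with ht | rfl
      · exact h' t ht
      · obtain ⟨k1, k2⟩ := key T h'
        exact ⟨by rw [k2, hL _ le_rfl], by rw [k1, hR _ le_rfl]⟩

/-! ### The observed bits -/

/-- The values of site `0` when the observed bits are `b`. -/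
def evenPart (b : ℕ → Bit) (t : ℕ) : Bit := b (2 * (t / 2))

/-- The values of site `1` when its initial value is `a` and the observed bits are `b`. -/
def oddPart (a : Bit) (b : ℕ → Bit) (t : ℕ) : Bit :=
  if t = 0 then a else b (2 * ((t - 1) / 2) + 1)

/-- The bits `b` are observed up to time `T`. -/
def Observed (b : ℕ → Bit) (T : ℕ) (s : ℤ → Bit) : Prop :=
  ∀ t ≤ T, evolve s t ((t % 2 : ℕ) : ℤ) = b t

/-- From time 1 on, each site is observed whenever it is updated and frozen in between, so the
zigzag determines both columns up to the initial value of site 1. -/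
theorem observed_iff_columns (b : ℕ → Bit) (T : ℕ) (s : ℤ → Bit) :
    Observed b T s ↔
      ∀ t ≤ T, evolve s t 0 = evenPart b t ∧ evolve s t 1 = oddPart (s 1) b t := by
  constructor
  · intro h t
    induction t with
    | zero =>
      intro _
      have := h 0 (Nat.zero_le _)
      exact ⟨by simpa [evenPart] using this, by simp [oddPart, evolve]⟩
    | succ t ih =>
      intro ht
      obtain ⟨i0, i1⟩ := ih (by omega)
      have ht' := h _ ht
      rcases Nat.even_or_odd' t with ⟨j, rfl | rfl⟩
      · rw [show (2 * j + 1) % 2 = 1 by omega] at ht'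
        constructor
        · rw [evolve_succ_of_odd _ (by simp), i0]
          simp only [evenPart]
          congr 1; omega
        · rw [show ((1 : ℕ) : ℤ) = 1 from rfl] at ht'
          rw [ht', oddPart, if_neg (by omega)]
          congr 1; omega
      · rw [show (2 * j + 1 + 1) % 2 = 0 by omega] at ht'
        constructor
        · rw [show ((0 : ℕ) : ℤ) = 0 from rfl] at ht'
          rw [ht', evenPart]
          congr 1; omega
        · rw [evolve_succ_of_odd _ (by rw [Int.even_iff]; push_cast; omega), i1]
          simp only [oddPart]
          rw [if_neg (by omega), if_neg (by omega)]
          congr 1; omega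
  · intro h t ht
    obtain ⟨h0, h1⟩ := h t ht
    rcases Nat.even_or_odd' t with ⟨j, rfl | rfl⟩
    · rw [show (2 * j) % 2 = 0 by omega]
      refine h0.trans ?_
      simp [evenPart]
    · rw [show (2 * j + 1) % 2 = 1 by omega]
      refine h1.trans ?_
      simp [oddPart]

/-- A neighbour equal to 1 flips the updated site: `chi a b 1 = 1 + b`. The forbidden triples are
those with middle bit 1 and no flip. -/
theorem Observed.not_forbidden {b : ℕ → Bit} {T : ℕ} {s : ℤ → Bit} (h : Observed b T s) {t : ℕ}
    (ht : t + 2 ≤ T) : ¬ Forbidden (b t) (b (t + 1)) (b (t + 2)) := by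
  have hc : ∀ a b c : Bit, c = 1 → ¬ Forbidden b c (chi a b c) := by decide
  have hF : ∀ p q r : Bit, q ≠ 1 → ¬ Forbidden p q r := by decide
  by_cases h1 : b (t + 1) = 1
  · rcases Nat.even_or_odd' t with ⟨j, rfl | rfl⟩
    · have a0 := h (2 * j) (by omega)
      have a1 := h (2 * j + 1) (by omega)
      have a2 := h (2 * j + 2) (by omega)
      rw [show (2 * j) % 2 = 0 by omega] at a0
      rw [show (2 * j + 1) % 2 = 1 by omega] at a1
      rw [show (2 * j + 2) % 2 = 0 by omega, Nat.cast_zero,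
        evolve_succ_of_even _ (by rw [Int.even_iff]; push_cast; omega),
        evolve_succ_of_odd (x := 0) _ (by rw [Int.even_iff]; push_cast; omega)] at a2
      rw [← a2, ← a0, ← a1]
      exact hc _ _ _ (a1.trans h1)
    · have a0 := h (2 * j + 1) (by omega)
      have a1 := h (2 * j + 1 + 1) (by omega)
      have a2 := h (2 * j + 1 + 2) (by omega)
      rw [show (2 * j + 1) % 2 = 1 by omega] at a0
      rw [show (2 * j + 1 + 1) % 2 = 0 by omega] at a1
      rw [show (2 * j + 1 + 2) % 2 = 1 by omega, Nat.cast_one,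
        evolve_succ_of_even _ (by rw [Int.even_iff]; push_cast; omega),
        evolve_succ_of_odd (x := 1) _ (by rw [Int.even_iff]; push_cast; omega), chi_comm] at a2
      rw [← a2, ← a0, ← a1]
      exact hc _ _ _ (a1.trans h1)
  · exact hF _ _ _ h1

theorem observed_split (b : ℕ → Bit) (T : ℕ) (s : ℤ → Bit) :
    ind (Observed b T s) =
      ind (∀ t ≤ T, column 0 (evenPart b) (fun j => s (j + 1 : ℕ)) t = oddPart (s 1) b t) *
      ind (∀ t ≤ T, column 1 (oddPart (s 1) b) (fun j => s (-(j : ℤ))) t = evenPart b t) := by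
  rw [← ind_and, ind_congr (observed_iff_columns b T s), ind_congr (evolve_columns_iff ..)]

/-! ### The time-state on a window -/

/-- Weight of the half-line to the right of site `0`, given the initial values `b 0` and `a` of the
sites `0` and `1`. -/
noncomputable def rightWeight (x y : ℝ) (k : ℕ) (a : Bit) (b : ℕ → Bit) (T : ℕ) : ℝ :=
  bathExp 0 x y (b 0) a k (fun s =>
    ind (∀ t ≤ T, column 0 (evenPart b) (consSeq a s) t = oddPart a b t))

/-- Weight of the half-line to the left of site `1`. -/
noncomputable def leftWeight (x y : ℝ) (k : ℕ) (a : Bit) (b : ℕ → Bit) (T : ℕ) : ℝ :=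
  bathExp 1 y x a (b 0) (k + 1) (fun s =>
    ind (∀ t ≤ T, column 1 (oddPart a b) (consSeq (b 0) s) t = evenPart b t))

/-- Probability, in the stationary state on the window `-(k + 1), …, k + 1`, to observe `b` up to
time `T`. -/
noncomputable def observedProb (x y : ℝ) (k : ℕ) (b : ℕ → Bit) (T : ℕ) : ℝ :=
  ∑ s : Fin (2 * (k + 1) + 1) → Bit,
    (if Even (k + 1) then statProb x y (List.ofFn s) else statProb y x (List.ofFn s)) *
      ind (Observed b T (extend (k + 1) s))

/-- Independence of the half-lines in the state and decoupling of their driven dynamics give a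
product; the sum is over the unobserved initial value of site 1. -/
theorem observedProb_eq (x y : ℝ) (k : ℕ) (b : ℕ → Bit) (T : ℕ) :
    observedProb x y k b T = ∑ a, statProb x y [b 0, a] *
      (rightWeight x y k a b T * leftWeight x y k a b T) := by
  rw [observedProb, window_sum x y k (fun s => ind (Observed b T s)), Finset.sum_comm]
  refine Finset.sum_congr rfl fun a _ => ?_
  have hs : ∀ c (l r : ℕ → Bit), ind (Observed b T fun z : ℤ =>
      if 0 ≤ z then consSeq c (consSeq a r) z.toNat else l (-z - 1).toNat) =
      ind (∀ t ≤ T, column 0 (evenPart b) (consSeq a r) t = oddPart a b t) *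
      ind (∀ t ≤ T, column 1 (oddPart a b) (consSeq c l) t = evenPart b t) := by
    intro c l r
    rw [observed_split]
    have e1 : (fun j : ℕ => (fun z : ℤ => if 0 ≤ z then consSeq c (consSeq a r) z.toNat
        else l (-z - 1).toNat) ((j + 1 : ℕ) : ℤ)) = consSeq a r := by
      funext j
      beta_reduce
      rw [if_pos (by omega)]; rfl
    have e2 : (fun j : ℕ => (fun z : ℤ => if 0 ≤ z then consSeq c (consSeq a r) z.toNat
        else l (-z - 1).toNat) (-(j : ℤ))) = consSeq c l := by
      funext j
      cases j with
      | zero => simp [consSeq]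
      | succ j =>
        beta_reduce
        rw [if_neg (by omega), show -(-((j + 1 : ℕ) : ℤ)) - 1 = j by push_cast; ring]
        simp [consSeq]
    simp only [e1, e2]
    rfl
  simp only [hs]
  rw [Finset.sum_eq_single (b 0)]
  · congr 1
    have hR : ∀ F, chainExp x y (b 0) a k F = bathExp 0 x y (b 0) a k F := by
      intro F; simp [bathExp]
    have hL : ∀ F, chainExp x y a (b 0) (k + 1) F = bathExp 1 y x a (b 0) (k + 1) F := by
      intro F; simp [bathExp]
    rw [rightWeight, leftWeight, ← hR, ← hL, ← chainExp_mul_left]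
    congr 1
    funext l
    rw [mul_comm, ← chainExp_mul_left]
    congr 1
    funext r
    ring
  · intro c _ hc
    have : ∀ l : ℕ → Bit,
        ind (∀ t ≤ T, column 1 (oddPart a b) (consSeq c l) t = evenPart b t) = 0 := by
      intro l
      refine ind_of_false fun h => hc ?_
      rw [← column_zero 1 (oddPart a b) c l, h 0 (Nat.zero_le _)]
      rfl
    simp only [this, mul_zero, chainExp_const]
  · simp

/-! ### The time-state as a Markov chain of memory three -/

theorem fixedColumnLaw (x y : ℝ) (N : ℕ) : FixedColumnLaw x y N := by
  cases N with
  | zero => intro f d o T h _ hN; omega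
  | succ N => exact fixedColumnLaw_succ (columnLaw x y N)

theorem ind_column_succ {f T : ℕ} {d o s : ℕ → Bit} (hf : ¬ Even (T + f))
    (ho : o (T + 1) = o T) :
    ind (∀ t ≤ T + 1, column f d s t = o t) = ind (∀ t ≤ T, column f d s t = o t) := by
  refine ind_congr ⟨fun h t ht => h t (by omega), fun h t ht => ?_⟩
  rcases Nat.le_succ_iff.1 ht with ht | rfl
  · exact h t ht
  · rw [column_succ_of_odd hf, h T le_rfl, ho]

theorem bathExp_column_step (x y : ℝ) {f N T : ℕ} {d o : ℕ → Bit} (hf : ¬ Even (T + f))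
    (hN : T + 2 ≤ N) (ho : o (T + 1) = o T) (hleg : o T = 1 → d (T + 1) = 1 + d T)
    (hd : d T = d (T - 1)) :
    bathExp f x y (d 0) (o 0) N (fun s =>
      ind (∀ t ≤ T + 2, column f d (consSeq (o 0) s) t = o t)) =
    condProb x (d T) (o T) (d (T + 1)) (o (T + 2)) * bathExp f x y (d 0) (o 0) N (fun s =>
      ind (∀ t ≤ T + 1, column f d (consSeq (o 0) s) t = o t)) := by
  have h1 : ∀ s, ind (∀ t ≤ T + 2, column f d (consSeq (o 0) s) t = o t) =
      ind (∀ t ≤ T, column f d (consSeq (o 0) s) t = o t) *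
        ind (column f d (consSeq (o 0) s) (T + 2) = o (T + 2)) := by
    intro s
    rw [← ind_column_succ hf ho, ← ind_and]
    refine ind_congr ⟨fun h => ⟨fun t ht => h t (by omega), h _ le_rfl⟩, fun h t ht => ?_⟩
    rcases Nat.le_succ_iff.1 ht with ht | rfl
    · exact h.1 t ht
    · exact h.2
  rw [bathExp_congr h1, bathExp_congr fun s => ind_column_succ hf ho,
    fixedColumnLaw x y N f d o T _ hf hN hleg hd]

theorem rightWeight_succ_of_even (x y : ℝ) (k : ℕ) (a : Bit) (b : ℕ → Bit) {T : ℕ}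
    (hT : ¬ Even T) : rightWeight x y k a b (T + 1) = rightWeight x y k a b T := by
  unfold rightWeight
  refine bathExp_congr fun s => ind_column_succ (by simpa using hT) ?_
  obtain ⟨j, rfl⟩ := Nat.not_even_iff_odd.1 hT
  simp only [oddPart]
  rw [if_neg (by omega), if_neg (by omega)]
  congr 1; omega

theorem leftWeight_succ_of_odd (x y : ℝ) (k : ℕ) (a : Bit) (b : ℕ → Bit) {T : ℕ}
    (hT : Even T) : leftWeight x y k a b (T + 1) = leftWeight x y k a b T := by
  unfold leftWeight
  refine bathExp_congr fun s => ind_column_succ (by simpa [Nat.even_add_one] using hT) ?_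
  obtain ⟨j, rfl⟩ := hT
  simp only [evenPart]
  congr 1; omega

theorem rightWeight_step (x y : ℝ) {k : ℕ} (a : Bit) (b : ℕ → Bit) {t : ℕ} (ht : Even t)
    (hk : t + 3 ≤ k) (hb : ¬ Forbidden (b t) (b (t + 1)) (b (t + 2))) :
    rightWeight x y k a b (t + 3) =
      condProb x (b t) (b (t + 1)) (b (t + 2)) (b (t + 3)) * rightWeight x y k a b (t + 2) := by
  obtain ⟨j, rfl⟩ := ht
  have e0 : evenPart b (j + j + 1) = b (j + j) := by
    simp only [evenPart]; congr 1; omega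
  have e1 : oddPart a b (j + j + 1) = b (j + j + 1) := by
    simp only [oddPart]; rw [if_neg (by omega)]; congr 1; omega
  have e2 : evenPart b (j + j + 1 + 1) = b (j + j + 2) := by
    simp only [evenPart]; congr 1; omega
  have e3 : oddPart a b (j + j + 1 + 2) = b (j + j + 3) := by
    simp only [oddPart]; rw [if_neg (by omega)]; congr 1; omega
  have h := bathExp_column_step x y (f := 0) (N := k) (T := j + j + 1) (d := evenPart b)
    (o := oddPart a b) (by simp [Nat.even_add_one]) hk ?_ ?_ ?_
  · rw [e0, e1, e2, e3] at h
    exact h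
  · simp only [oddPart]
    rw [if_neg (by omega), if_neg (by omega)]
    congr 1; omega
  -- Legality of the driver is the absence of a forbidden triple: if the middle bit is 1, the outer
  -- two differ.
  · rw [e0, e1, e2]
    intro h1
    rw [h1] at hb
    revert hb
    generalize b (j + j) = p
    generalize b (j + j + 2) = q
    revert p q; decide
  · simp only [evenPart]; congr 1; omega

theorem leftWeight_step (x y : ℝ) {k : ℕ} (a : Bit) (b : ℕ → Bit) {t : ℕ} (ht : ¬ Even t)
    (hk : t + 3 ≤ k + 1) (hb : ¬ Forbidden (b t) (b (t + 1)) (b (t + 2))) :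
    leftWeight x y k a b (t + 3) =
      condProb y (b t) (b (t + 1)) (b (t + 2)) (b (t + 3)) * leftWeight x y k a b (t + 2) := by
  obtain ⟨j, rfl⟩ := Nat.not_even_iff_odd.1 ht
  have e0 : oddPart a b (2 * j + 1 + 1) = b (2 * j + 1) := by
    simp only [oddPart]; rw [if_neg (by omega)]; congr 1; omega
  have e1 : evenPart b (2 * j + 1 + 1) = b (2 * j + 1 + 1) := by
    simp only [evenPart]; congr 1; omega
  have e2 : oddPart a b (2 * j + 1 + 1 + 1) = b (2 * j + 1 + 2) := by
    simp only [oddPart]; rw [if_neg (by omega)]; congr 1; omega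
  have e3 : evenPart b (2 * j + 1 + 1 + 2) = b (2 * j + 1 + 3) := by
    simp only [evenPart]; congr 1; omega
  have h := bathExp_column_step y x (f := 1) (N := k + 1) (T := 2 * j + 1 + 1) (d := oddPart a b)
    (o := evenPart b) (by simp [Nat.even_add_one]) hk ?_ ?_ ?_
  · rw [e0, e1, e2, e3] at h
    exact h
  · simp only [evenPart]
    congr 1; omega
  · rw [e0, e1, e2]
    intro h1
    rw [h1] at hb
    revert hb
    generalize b (2 * j + 1) = p
    generalize b (2 * j + 1 + 2) = q
    revert p q; decide
  · simp only [oddPart]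
    rw [if_neg (by omega), if_neg (by omega)]
    congr 1; omega

theorem observedProb_of_forbidden (x y : ℝ) (k : ℕ) {b : ℕ → Bit} {t T : ℕ} (ht : t + 2 ≤ T)
    (h : Forbidden (b t) (b (t + 1)) (b (t + 2))) : observedProb x y k b T = 0 := by
  unfold observedProb
  refine Finset.sum_eq_zero fun s _ => ?_
  rw [ind_of_false fun hs => hs.not_forbidden ht h, mul_zero]

/-- Markov property of the time-state. -/
theorem observedProb_step (x y : ℝ) {k : ℕ} (b : ℕ → Bit) {t : ℕ}
    (hk : t + 3 ≤ k ∨ (t + 3 = k + 1 ∧ Even (t + 3))) :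
    observedProb x y k b (t + 3) =
      condProb (if Even (t + 3) then y else x) (b t) (b (t + 1)) (b (t + 2)) (b (t + 3)) *
        observedProb x y k b (t + 2) := by
  by_cases hb : Forbidden (b t) (b (t + 1)) (b (t + 2))
  · rw [observedProb_of_forbidden x y k (by omega) hb,
      observedProb_of_forbidden x y k (by omega) hb, mul_zero]
  rw [observedProb_eq, observedProb_eq, Finset.mul_sum]
  refine Finset.sum_congr rfl fun a _ => ?_
  -- The last bit sits on site 1 if `t` is even and on site 0 if `t` is odd, and only the
  -- corresponding half-line acquires a factor. The left bath has one site more, which is why `t + 3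
  -- = k + 1` is allowed when `t + 3` is even.
  by_cases ht : Even t
  · have h3 : ¬ Even (t + 3) := by simp [parity_simps, ht]
    rw [if_neg h3, rightWeight_step x y a b ht (by tauto) hb,
      leftWeight_succ_of_odd x y k a b (T := t + 2) (by simpa [Nat.even_add] using ht)]
    ring
  · have h3 : Even (t + 3) := by simp [Nat.even_add, ht]; decide
    rw [if_pos h3, leftWeight_step x y a b ht (by omega) hb,
      rightWeight_succ_of_even x y k a b (T := t + 2) (by simpa [Nat.even_add] using ht)]
    ring

theorem rightWeight_zero (x y : ℝ) (k : ℕ) (a : Bit) (b : ℕ → Bit) :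
    rightWeight x y k a b 0 = 1 := by
  unfold rightWeight
  rw [← bathExp_const 0 x y (b 0) a k 1]
  refine bathExp_congr fun s => ind_of_true ?_
  intro t ht
  obtain rfl : t = 0 := by omega
  simp [column_zero, oddPart]

theorem leftWeight_zero (x y : ℝ) (k : ℕ) (a : Bit) (b : ℕ → Bit) :
    leftWeight x y k a b 0 = 1 := by
  unfold leftWeight
  rw [← bathExp_const 1 y x a (b 0) (k + 1) 1]
  refine bathExp_congr fun s => ind_of_true ?_
  intro t ht
  obtain rfl : t = 0 := by omega
  simp [column_zero, evenPart]

/-- Site 1 is already updated in the first step, before the two-step column law can apply, so this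
factor is read off from the initial state. -/
theorem rightWeight_one (x y : ℝ) (k : ℕ) (a : Bit) (b : ℕ → Bit) :
    rightWeight x y (k + 1) a b 1 =
      ∑ e, nextProb x y (b 0) a e * ind (chi (b 0) a e = b 1) := by
  unfold rightWeight
  rw [bathExp_succ]
  refine Finset.sum_congr rfl fun e _ => ?_
  rw [if_pos (by decide)]
  congr 1
  rw [← bathExp_const (0 + 1) x y a e k (ind (chi (b 0) a e = b 1))]
  refine bathExp_congr fun s => ind_congr ?_
  have h1 : column 0 (evenPart b) (consSeq a (consSeq e s)) 1 = chi (b 0) a e := by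
    rw [column_succ_of_even (T := 0) (o := fun _ => a) (by decide)]
    · rw [column_zero]; rfl
    · intro t ht
      obtain rfl : t = 0 := by omega
      rw [column_zero]
  constructor
  · intro h
    rw [← h1, h 1 le_rfl]; rfl
  · intro h t ht
    interval_cases t
    · rw [column_zero]; rfl
    · rw [h1, h]; rfl

theorem leftWeight_two (x y : ℝ) {k : ℕ} (hk : 1 ≤ k) (a : Bit) (b : ℕ → Bit)
    (hb : b 0 = 1 → b 1 = 1 + a) :
    leftWeight x y k a b 2 = condProb y a (b 0) (b 1) (b 2) := by
  have h := bathExp_column_step y x (f := 1) (N := k + 1) (T := 0) (d := oddPart a b)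
    (o := evenPart b) (by decide) (by omega) rfl ?_ rfl
  · have h1 := leftWeight_succ_of_odd x y k a b (T := 0) (by decide)
    rw [leftWeight_zero] at h1
    have h2 : leftWeight x y k a b 2 =
      condProb y a (b 0) (b 1) (b 2) * leftWeight x y k a b 1 := h
    rw [h2, h1, mul_one]
  · exact hb

theorem observedProb_zero (x y : ℝ) (k : ℕ) (b : ℕ → Bit) :
    observedProb x y k b 0 = ∑ a, statProb x y [b 0, a] := by
  simp [observedProb_eq, rightWeight_zero, leftWeight_zero]

theorem observedProb_one (x y : ℝ) (k : ℕ) (b : ℕ → Bit) :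
    observedProb x y (k + 1) b 1 = ∑ a, statProb x y [b 0, a] *
      ∑ e, nextProb x y (b 0) a e * ind (chi (b 0) a e = b 1) := by
  simp only [observedProb_eq, rightWeight_one]
  have h1 := fun a => leftWeight_succ_of_odd x y (k + 1) a b (T := 0) (by decide)
  simp only [zero_add, leftWeight_zero] at h1
  simp [h1]

theorem observedProb_two (x y : ℝ) (k : ℕ) (b : ℕ → Bit) :
    observedProb x y (k + 1) b 2 = ∑ a, statProb x y [b 0, a] *
      ((∑ e, nextProb x y (b 0) a e * ind (chi (b 0) a e = b 1)) *
        condProb y a (b 0) (b 1) (b 2)) := by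
  rw [observedProb_eq]
  refine Finset.sum_congr rfl fun a _ => ?_
  rw [rightWeight_succ_of_even x y _ a b (T := 1) (by decide), rightWeight_one]
  by_cases hb : b 0 = 1 → b 1 = 1 + a
  · rw [leftWeight_two x y (by omega) a b hb]
  -- Here the driver of the left half-line is illegal; the right factor vanishes since `chi 1 a e =
  -- 1 + a`.
  · have hz : ∑ e, nextProb x y (b 0) a e * ind (chi (b 0) a e = b 1) = 0 := by
      refine Finset.sum_eq_zero fun e _ => ?_
      rw [ind_of_false, mul_zero]
      intro h
      apply hb
      intro h0
      rw [h0] at h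
      rw [← h]
      have : ∀ a e : Bit, chi 1 a e = 1 + a := by decide
      exact this a e
    rw [hz]; ring

/-! ### Comparison with the matrix product form -/

/-- Two consecutive matrices have a product of rank at most one, so the factor is determined by `b,
c`. The bit `a` enters only because the product over a forbidden triple vanishes. -/
theorem A_mulVec_condProb (p q : ℝ) (a b c d : Bit) :
    A p q a *ᵥ (A q p b *ᵥ (A p q c *ᵥ (A q p d *ᵥ vecR))) =
      condProb q a b c d • (A p q a *ᵥ (A q p b *ᵥ (A p q c *ᵥ vecR))) := by
  rcases bit_cases a with rfl | rfl <;> rcases bit_cases b with rfl | rfl <;>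
  rcases bit_cases c with rfl | rfl <;> rcases bit_cases d with rfl | rfl <;>
    funext i <;> fin_cases i <;>
    simp [A, vecR, condProb, Forbidden, Matrix.mulVec, dotProduct, Fin.sum_univ_three] <;>
    first | ring1 | (left; ring1)

theorem wordA_append (p q : ℝ) (u v : List Bit) :
    wordA p q (u ++ v) =
      wordA p q u * (if Even u.length then wordA p q v else wordA q p v) := by
  induction u generalizing p q with
  | nil => simp [wordA]
  | cons c u ih =>
    rw [List.cons_append, wordA, ih, wordA, mul_assoc, List.length_cons]
    by_cases h : Even u.length <;> simp [Nat.even_add_one, h]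

theorem sandwich_step (p q : ℝ) (u : List Bit) (a b c d : Bit) :
    sandwich p q (wordA p q (u ++ [a, b, c, d])) =
      condProb (if Even (u.length + 3) then p else q) a b c d *
        sandwich p q (wordA p q (u ++ [a, b, c])) := by
  unfold sandwich
  rw [wordA_append, wordA_append, ← Matrix.mulVec_mulVec, ← Matrix.mulVec_mulVec]
  by_cases h : Even u.length
  · have h3 : ¬ Even (u.length + 3) := by simp [Nat.even_add, h]; decide
    rw [if_pos h, if_pos h, if_neg h3]
    simp only [wordA, mul_one, ← Matrix.mulVec_mulVec, A_mulVec_condProb]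
    rw [Matrix.mulVec_smul, dotProduct_smul, smul_eq_mul]
  · have h3 : Even (u.length + 3) := by simp [Nat.even_add, h]; decide
    rw [if_neg h, if_neg h, if_pos h3]
    simp only [wordA, mul_one, ← Matrix.mulVec_mulVec, A_mulVec_condProb]
    rw [Matrix.mulVec_smul, dotProduct_smul, smul_eq_mul]

/-- The first `m` terms of a sequence. -/
def firstBits (b : ℕ → Bit) (m : ℕ) : List Bit := List.ofFn fun i : Fin m => b i

theorem firstBits_succ (b : ℕ → Bit) (m : ℕ) : firstBits b (m + 1) = firstBits b m ++ [b m] := by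
  rw [firstBits, List.ofFn_succ_last]
  rfl

/-- Both sides obey the same one-bit recursion once three bits precede, which leaves words of one,
two and three bits to be compared. -/
theorem observedProb_eq_sandwich {x y : ℝ} (hx : 0 < x) (hy : 0 < y) {k : ℕ} (b : ℕ → Bit)
    {T : ℕ} (hk : T ≤ k ∨ (T = k + 1 ∧ Even T)) :
    observedProb x y k b T = sandwich y x (wordA y x (firstBits b (T + 1))) := by
  have hN : 1 + x + y ≠ 0 := by positivity
  have hN' : 1 + y + x ≠ 0 := by positivity
  have h11 : (1 : Bit) + 1 = 0 := by decide
  induction T with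
  | zero =>
    rw [observedProb_zero]
    rw [show firstBits b (0 + 1) = [b 0] by simp [firstBits]]
    simp only [wordA, mul_one]
    generalize b 0 = b0
    rcases bit_cases b0 with rfl | rfl <;>
      simp [statProb, sandwich, statRow, vecL, vecR, sum_bit, P, wordP, A, Matrix.mulVec,
        dotProduct, Fin.sum_univ_three] <;> field_simp <;> ring
  | succ T ih =>
    match T, ih, hk with
    | 0, ih, hk =>
      obtain ⟨k, rfl⟩ : ∃ m, k = m + 1 := ⟨k - 1, by
        rcases hk with h | ⟨_, h⟩
        · omega
        · exact absurd h (by decide)⟩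
      rw [observedProb_one]
      rw [show firstBits b (0 + 1 + 1) = [b 0, b 1] by simp [firstBits]]
      simp only [wordA, mul_one, sandwich, ← Matrix.mulVec_mulVec]
      generalize b 0 = b0
      generalize b 1 = b1
      rcases bit_cases b0 with rfl | rfl <;> rcases bit_cases b1 with rfl | rfl <;>
        simp [statProb, statRow, vecL, vecR, sum_bit, P, wordP, A, Matrix.mulVec,
          dotProduct, Fin.sum_univ_three, Matrix.mul_apply, ind, chi, h11, nextProb, bern] <;>
        field_simp <;> ring
    | 1, ih, hk =>
      obtain ⟨k, rfl⟩ : ∃ m, k = m + 1 := ⟨k - 1, by omega⟩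
      rw [observedProb_two]
      rw [show firstBits b (1 + 1 + 1) = [b 0, b 1, b 2] by simp [firstBits]]
      simp only [wordA, mul_one, sandwich, ← Matrix.mulVec_mulVec]
      generalize b 0 = b0
      generalize b 1 = b1
      generalize b 2 = b2
      rcases bit_cases b0 with rfl | rfl <;> rcases bit_cases b1 with rfl | rfl <;>
      rcases bit_cases b2 with rfl | rfl <;>
        simp [statProb, statRow, vecL, vecR, sum_bit, P, wordP, A, Matrix.mulVec,
          dotProduct, Fin.sum_univ_three, Matrix.mul_apply, ind, chi, h11, nextProb, bern,
          condProb, Forbidden] <;>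
        field_simp <;> first | ring1 | (left; ring1)
    | t + 2, ih, hk =>
      rw [observedProb_step x y b hk, ih (by omega)]
      have e3 : firstBits b (t + 2 + 1) = firstBits b t ++ [b t, b (t + 1), b (t + 2)] := by
        simp [firstBits_succ]
      have e4 : firstBits b (t + 2 + 1 + 1) =
          firstBits b t ++ [b t, b (t + 1), b (t + 2), b (t + 3)] := by
        simp [firstBits_succ]
      rw [e3, e4, sandwich_step]
      simp [firstBits]

/-! ### Expectations in the stationary state -/

/-- Stationary probability of a word that starts on the given row. -/
noncomputable def rowProb (x y : ℝ) : Row → List Bit → ℝ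
  | .lower, w => statProb x y w
  | .upper, w => statProb y x w

theorem ofFn_eq_firstBits {m : ℕ} (b : Fin m → Bit) : List.ofFn b = firstBits (pad b) m := by
  unfold firstBits
  congr 1
  funext i
  simp [pad]

theorem expect_observed {ξ ω x y : ℝ} (H : ∀ r w, blockProb ξ ω r w = rowProb x y r w) (k : ℕ)
    (b : ℕ → Bit) (T : ℕ) :
    expect ξ ω (k + 1) (fun s => ind (Observed b T s)) = observedProb x y k b T := by
  unfold expect observedProb
  refine Finset.sum_congr rfl fun s _ => ?_
  rw [H, startRow]
  split_ifs <;> rfl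

theorem sumA_mulVec_vecR (p q : ℝ) : sumA p q *ᵥ vecR = vecR := by
  funext i
  fin_cases i <;>
    simp [sumA, A, vecR, Matrix.mulVec, dotProduct, Fin.sum_univ_three, Matrix.add_apply]

/-- Summing over the earliest bit exchanges the fillings in the left vector: the time-state is
stationary under shifts by two steps. -/
theorem vecL_vecMul_sumA (p q : ℝ) : vecL p q ᵥ* sumA p q = vecL q p := by
  simp only [vecL, Matrix.smul_vecMul, add_right_comm 1 q p]
  congr 1
  funext i
  fin_cases i <;>
    simp [sumA, A, Matrix.vecMul, dotProduct, Fin.sum_univ_three, Matrix.add_apply]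

theorem sandwich_sum (p q : ℝ) {ι : Type*} (S : Finset ι) (M : ι → Matrix (Fin 3) (Fin 3) ℝ) :
    sandwich p q (∑ i ∈ S, M i) = ∑ i ∈ S, sandwich p q (M i) := by
  simp only [sandwich, Matrix.sum_mulVec, dotProduct_sum]

theorem sandwich_one {p q : ℝ} (hp : 0 < p) (hq : 0 < q) : sandwich p q 1 = 1 := by
  have : 1 + p + q ≠ 0 := by positivity
  simp [sandwich, vecL, vecR, dotProduct, Fin.sum_univ_three]
  field_simp
  ring

/-- Sum of the alternating products over all words of a given length. -/
noncomputable def wordSum (p q : ℝ) (n : ℕ) : Matrix (Fin 3) (Fin 3) ℝ :=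
  ∑ b : Fin n → Bit, wordA p q (List.ofFn b)

theorem wordSum_zero (p q : ℝ) : wordSum p q 0 = 1 := by
  simp [wordSum, wordA]

theorem wordSum_succ (p q : ℝ) (n : ℕ) : wordSum p q (n + 1) = sumA p q * wordSum q p n := by
  rw [wordSum, sum_ofFn_cons n (wordA p q), sum_bit]
  simp only [wordA, ← Finset.mul_sum, sumA, add_mul]
  rfl

theorem wordSum_mulVec_vecR (p q : ℝ) (n : ℕ) : wordSum p q n *ᵥ vecR = vecR := by
  induction n generalizing p q with
  | zero => simp [wordSum_zero]
  | succ n ih => rw [wordSum_succ, ← Matrix.mulVec_mulVec, ih, sumA_mulVec_vecR]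

theorem vecL_vecMul_wordSum (p q : ℝ) (j : ℕ) : vecL p q ᵥ* wordSum p q (2 * j) = vecL p q := by
  induction j with
  | zero => simp [wordSum_zero]
  | succ j ih =>
    rw [show 2 * (j + 1) = 2 * j + 1 + 1 by ring, wordSum_succ, wordSum_succ,
      ← Matrix.vecMul_vecMul, ← Matrix.vecMul_vecMul, vecL_vecMul_sumA, vecL_vecMul_sumA, ih]

theorem wordSum_odd (p q : ℝ) (j : ℕ) :
    wordSum p q (2 * j + 1) = (sumA p q * sumA q p) ^ j * sumA p q := by
  induction j with
  | zero => simp [wordSum_succ, wordSum_zero]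
  | succ j ih =>
    rw [show 2 * (j + 1) + 1 = 2 * j + 1 + 1 + 1 by ring, wordSum_succ, wordSum_succ, ih,
      pow_succ', mul_assoc, mul_assoc]

theorem timeState_succ_eq {ξ ω x y : ℝ} (H : ∀ r w, blockProb ξ ω r w = rowProb x y r w) {T : ℕ}
    (b : Fin (T + 1) → Bit) : timeState ξ ω (T + 1) b = observedProb x y T (pad b) T := by
  rw [← expect_observed H, timeState]
  congr 1
  funext s
  have : (∀ t : Fin (T + 1), evolve s (t : ℕ) (((t : ℕ) % 2 : ℕ) : ℤ) = b t) ↔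
      Observed (pad b) T s := by
    constructor
    · intro h t ht
      rw [h ⟨t, by omega⟩, pad, dif_pos (by omega)]
    · intro h t
      rw [h t (by omega), pad, dif_pos t.2]
  by_cases h : Observed (pad b) T s
  · rw [ind_of_true h]
    exact if_pos (this.2 h)
  · rw [ind_of_false h]
    exact if_neg (mt this.1 h)

/-- The matrix product form of the time-state. -/
theorem timeState_eq_sandwich {ξ ω x y : ℝ} (hx : 0 < x) (hy : 0 < y)
    (H : ∀ r w, blockProb ξ ω r w = rowProb x y r w) {m : ℕ} (b : Fin m → Bit) :
    timeState ξ ω m b = sandwich y x (wordA y x (List.ofFn b)) := by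
  cases m with
  | zero =>
    have hN : 1 + x + y ≠ 0 := by positivity
    have h0 : timeState ξ ω 0 b = ∑ s : Fin (0 + 1) → Bit, statProb x y (List.ofFn s) := by
      unfold timeState expect
      refine Finset.sum_congr rfl fun s _ => ?_
      beta_reduce
      rw [H, if_pos (fun t : Fin 0 => t.elim0), mul_one]
      rfl
    rw [h0, sum_ofFn_cons 0 (statProb x y)]
    simp only [List.ofFn_zero, wordA, sandwich_one hy hx]
    simp [sum_bit, statProb, wordP, P, statRow, vecR, Matrix.mulVec, dotProduct,
      Fin.sum_univ_three]
    field_simp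
    ring
  | succ T =>
    rw [timeState_succ_eq H, observedProb_eq_sandwich hx hy _ (Or.inl le_rfl), ofFn_eq_firstBits]

theorem sum_timeState {ξ ω x y : ℝ} (hx : 0 < x) (hy : 0 < y)
    (H : ∀ r w, blockProb ξ ω r w = rowProb x y r w) (m : ℕ) :
    ∑ b : Fin m → Bit, timeState ξ ω m b = 1 := by
  simp only [timeState_eq_sandwich hx hy H]
  rw [← sandwich_sum]
  change sandwich y x (wordSum y x m) = 1
  rw [← sandwich_one hy hx, sandwich, sandwich, wordSum_mulVec_vecR, Matrix.one_mulVec]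

/-! ### Support of the time-state -/

theorem condProb_nonneg {p : ℝ} (h0 : 0 < p) (h1 : p < 1) (a b c d : Bit) :
    0 ≤ condProb p a b c d := by
  unfold condProb
  split_ifs <;> linarith

theorem condProb_ne_zero {p : ℝ} (h0 : 0 < p) (h1 : p < 1) {a b c : Bit} (d : Bit)
    (h : ¬ Forbidden a b c) : condProb p a b c d ≠ 0 ↔ ¬ Forbidden b c d := by
  have h0' : p ≠ 0 := h0.ne'
  have h1' : 1 - p ≠ 0 := by linarith
  rcases bit_cases a with rfl | rfl <;> rcases bit_cases b with rfl | rfl <;>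
  rcases bit_cases c with rfl | rfl <;> rcases bit_cases d with rfl | rfl <;>
    first
      | exact absurd h (by decide)
      | simp [condProb, Forbidden, h0', h1']

theorem sandwich_three {p q : ℝ} (hp : 0 < p) (hp1 : p < 1) (hq : 0 < q) (hq1 : q < 1)
    (a b c : Bit) :
    0 ≤ sandwich p q (wordA p q [a, b, c]) ∧
      (sandwich p q (wordA p q [a, b, c]) ≠ 0 ↔ ¬ Forbidden a b c) := by
  have hp' : 0 < 1 - p := by linarith
  have hq' : 0 < 1 - q := by linarith
  have key : ∀ {r : ℝ} {P : Prop}, (P → r = 0) → (¬ P → 0 < r) → 0 ≤ r ∧ (r ≠ 0 ↔ ¬ P) := by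
    intro r P h1 h2
    by_cases hP : P
    · simp [h1 hP, hP]
    · simp [hP, (h2 hP).le, (h2 hP).ne']
  simp only [wordA, mul_one, sandwich, ← Matrix.mulVec_mulVec]
  refine key ?_ ?_
  · rintro (⟨rfl, rfl, rfl⟩ | ⟨rfl, rfl, rfl⟩) <;>
      simp [vecL, vecR, A, Matrix.mulVec, dotProduct, Fin.sum_univ_three]
  · intro h
    rcases bit_cases a with rfl | rfl <;> rcases bit_cases b with rfl | rfl <;>
    rcases bit_cases c with rfl | rfl <;>
      first
        | exact absurd h (by decide)
        | (simp [vecL, vecR, A, Matrix.mulVec, dotProduct, Fin.sum_univ_three]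
           try generalize 1 - p = p' at *
           try generalize 1 - q = q' at *
           positivity)

theorem sandwich_two_pos {p q : ℝ} (hp : 0 < p) (hp1 : p < 1) (hq : 0 < q) (hq1 : q < 1)
    (a b : Bit) : 0 < sandwich p q (wordA p q [a, b]) := by
  have hp' : 0 < 1 - p := by linarith
  have hq' : 0 < 1 - q := by linarith
  simp only [wordA, mul_one, sandwich, ← Matrix.mulVec_mulVec]
  rcases bit_cases a with rfl | rfl <;> rcases bit_cases b with rfl | rfl <;>
    simp [vecL, vecR, A, Matrix.mulVec, dotProduct, Fin.sum_univ_three] <;>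
    generalize 1 - p = p' at * <;> generalize 1 - q = q' at * <;> positivity

theorem sandwich_single_pos {p q : ℝ} (hp : 0 < p) (hp1 : p < 1) (hq : 0 < q) (a : Bit) :
    0 < sandwich p q (wordA p q [a]) := by
  have hp' : 0 < 1 - p := by linarith
  simp only [wordA, mul_one, sandwich]
  rcases bit_cases a with rfl | rfl <;>
    simp [vecL, vecR, A, Matrix.mulVec, dotProduct, Fin.sum_univ_three] <;>
    generalize 1 - p = p' at * <;> positivity

theorem firstBits_three (b : ℕ → Bit) (t : ℕ) :
    firstBits b (t + 3) = firstBits b t ++ [b t, b (t + 1), b (t + 2)] := by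
  simp [firstBits_succ]

theorem firstBits_four (b : ℕ → Bit) (t : ℕ) :
    firstBits b (t + 4) = firstBits b t ++ [b t, b (t + 1), b (t + 2), b (t + 3)] := by
  simp [firstBits_succ]

theorem sandwich_firstBits_step (p q : ℝ) (b : ℕ → Bit) (t : ℕ) :
    sandwich p q (wordA p q (firstBits b (t + 4))) =
      condProb (if Even (t + 3) then p else q) (b t) (b (t + 1)) (b (t + 2)) (b (t + 3)) *
        sandwich p q (wordA p q (firstBits b (t + 3))) := by
  rw [firstBits_four, firstBits_three, sandwich_step]
  simp [firstBits]

theorem sandwich_support {p q : ℝ} (hp : 0 < p) (hp1 : p < 1) (hq : 0 < q) (hq1 : q < 1)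
    (b : ℕ → Bit) (m : ℕ) :
    0 ≤ sandwich p q (wordA p q (firstBits b m)) ∧
      (sandwich p q (wordA p q (firstBits b m)) ≠ 0 ↔
        ∀ i, i + 2 < m → ¬ Forbidden (b i) (b (i + 1)) (b (i + 2))) := by
  induction m with
  | zero =>
    have : firstBits b 0 = [] := rfl
    rw [this, wordA, sandwich_one hp hq]
    simp
  | succ m ih =>
    match m, ih with
    | 0, _ =>
      have h := sandwich_single_pos hp hp1 hq (b 0)
      rw [show firstBits b (0 + 1) = [b 0] by simp [firstBits]]
      exact ⟨h.le, iff_of_true h.ne' fun i hi => by omega⟩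
    | 1, _ =>
      have h := sandwich_two_pos hp hp1 hq hq1 (b 0) (b 1)
      rw [show firstBits b (1 + 1) = [b 0, b 1] by simp [firstBits]]
      exact ⟨h.le, iff_of_true h.ne' fun i hi => by omega⟩
    | 2, _ =>
      have h := sandwich_three hp hp1 hq hq1 (b 0) (b 1) (b 2)
      rw [show firstBits b (2 + 1) = [b 0, b 1, b 2] by simp [firstBits]]
      refine ⟨h.1, h.2.trans ⟨fun h' i hi => ?_, fun h' => h' 0 (by omega)⟩⟩
      obtain rfl : i = 0 := by omega
      exact h'
    | t + 3, ih =>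
      rw [sandwich_firstBits_step]
      have hθ0 : 0 < (if Even (t + 3) then p else q) := by split_ifs <;> assumption
      have hθ1 : (if Even (t + 3) then p else q) < 1 := by split_ifs <;> assumption
      refine ⟨mul_nonneg (condProb_nonneg hθ0 hθ1 _ _ _ _) ih.1, ?_⟩
      rw [mul_ne_zero_iff, ih.2]
      constructor
      · rintro ⟨h1, h2⟩ i hi
        rcases Nat.lt_succ_iff_lt_or_eq.1 (show i < t + 1 + 1 by omega) with h | rfl
        · exact h2 i (by omega)
        · exact (condProb_ne_zero hθ0 hθ1 _ (h2 t (by omega))).1 h1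
      · intro h
        exact ⟨(condProb_ne_zero hθ0 hθ1 _ (h t (by omega))).2 (h (t + 1) (by omega)),
          fun i hi => h i (by omega)⟩

theorem accessible_iff {m : ℕ} (b : Fin m → Bit) :
    Accessible b ↔ ∀ i, i + 2 < m → ¬ Forbidden (pad b i) (pad b (i + 1)) (pad b (i + 2)) := by
  refine forall₂_congr fun i hi => ?_
  simp only [pad]
  rw [dif_pos (by omega), dif_pos (by omega), dif_pos hi]

theorem timeState_support {ξ ω x y : ℝ} (hx : 0 < x) (hx1 : x < 1) (hy : 0 < y) (hy1 : y < 1)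
    (H : ∀ r w, blockProb ξ ω r w = rowProb x y r w) {m : ℕ} (b : Fin m → Bit) :
    0 ≤ timeState ξ ω m b ∧ (timeState ξ ω m b ≠ 0 ↔ Accessible b) := by
  rw [timeState_eq_sandwich hx hy H, ofFn_eq_firstBits, accessible_iff]
  exact sandwich_support hy hy1 hx hx1 (pad b) m

theorem timeState_markov {ξ ω x y : ℝ} (hx : 0 < x) (hy : 0 < y)
    (H : ∀ r w, blockProb ξ ω r w = rowProb x y r w) {k : ℕ} (b : Fin (k + 4) → Bit)
    (hb : timeState ξ ω (k + 3) (fun i => b i.castSucc) ≠ 0) :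
    timeState ξ ω (k + 4) b / timeState ξ ω (k + 3) (fun i => b i.castSucc) =
      condProb (if Even (k + 3) then y else x)
        (pad b k) (pad b (k + 1)) (pad b (k + 2)) (pad b (k + 3)) := by
  rw [div_eq_iff hb, timeState_eq_sandwich hx hy H, timeState_eq_sandwich hx hy H,
    ofFn_eq_firstBits, sandwich_firstBits_step]
  have h3 : firstBits (pad b) (k + 3) = List.ofFn fun i : Fin (k + 3) => b i.castSucc := by
    unfold firstBits
    congr 1
    funext i
    simp only [pad]
    rw [dif_pos (by omega)]
    rfl
  rw [h3]

/-! ### One-site correlations -/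

theorem expect_sum {ξ ω : ℝ} (n : ℕ) {ι : Type*} (S : Finset ι) (F : ι → (ℤ → Bit) → ℝ) :
    expect ξ ω n (fun s => ∑ i ∈ S, F i s) = ∑ i ∈ S, expect ξ ω n (F i) := by
  simp only [expect, Finset.mul_sum]
  exact Finset.sum_comm

theorem expect_mul_left {ξ ω : ℝ} (n : ℕ) (r : ℝ) (F : (ℤ → Bit) → ℝ) :
    expect ξ ω n (fun s => r * F s) = r * expect ξ ω n F := by
  simp only [expect, Finset.mul_sum]
  exact Finset.sum_congr rfl fun s _ => by ring

/-- Expectation of a function of the observed bits. -/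
theorem expect_history {ξ ω x y : ℝ} (hx : 0 < x) (hy : 0 < y)
    (H : ∀ r w, blockProb ξ ω r w = rowProb x y r w) {k T : ℕ}
    (hk : T ≤ k ∨ (T = k + 1 ∧ Even T)) (Φ : (ℕ → Bit) → ℝ)
    (hΦ : ∀ c c' : ℕ → Bit, (∀ t ≤ T, c t = c' t) → Φ c = Φ c') :
    expect ξ ω (k + 1) (fun s => Φ fun t => evolve s t ((t % 2 : ℕ) : ℤ)) =
      ∑ c : Fin (T + 1) → Bit, Φ (pad c) * sandwich y x (wordA y x (List.ofFn c)) := by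
  have h1 : (fun s : ℤ → Bit => Φ fun t => evolve s t ((t % 2 : ℕ) : ℤ)) = fun s =>
      ∑ c : Fin (T + 1) → Bit, Φ (pad c) * ind (Observed (pad c) T s) := by
    funext s
    exact eq_sum_ind Φ hΦ _
  rw [h1, expect_sum]
  refine Finset.sum_congr rfl fun c _ => ?_
  rw [expect_mul_left, expect_observed H, observedProb_eq_sandwich hx hy _ hk, ofFn_eq_firstBits]

theorem sum_ind_mul (F : Bit → ℝ) : ∑ c, ind (c = 1) * F c = F 1 := by
  simp [ind]

theorem density_eq (s : ℤ → Bit) (j : ℕ) :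
    density (2 * j) s = ind (evolve s (2 * j) ((2 * j % 2 : ℕ) : ℤ) = 1) := by
  rw [show 2 * j % 2 = 0 by omega]
  by_cases h : evolve s (2 * j) 0 = 1
  · exact (if_pos h).trans (ind_of_true h).symm
  · exact (if_neg h).trans (ind_of_false h).symm

theorem pad_zero {n : ℕ} (c : Fin (n + 1) → Bit) : pad c 0 = c 0 := by
  simp [pad]

theorem pad_last {n : ℕ} (c : Fin (n + 1) → Bit) : pad c n = c (Fin.last n) := by
  simp [pad]; rfl

theorem sum_fin_snoc {M : Type*} [AddCommMonoid M] {n : ℕ} (F : (Fin (n + 1) → Bit) → M) :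
    ∑ c, F c = ∑ e, ∑ v : Fin n → Bit, F (Fin.snoc v e) := by
  rw [← Fintype.sum_prod_type']
  exact (Fintype.sum_equiv (Fin.snocEquiv (fun _ => Bit)) _ _ (fun _ => rfl)).symm

theorem ofFn_snoc {n : ℕ} (v : Fin n → Bit) (e : Bit) :
    List.ofFn (Fin.snoc v e : Fin (n + 1) → Bit) = List.ofFn v ++ [e] := by
  rw [List.ofFn_succ_last]
  simp

theorem sum_first_one (p q : ℝ) (n : ℕ) :
    ∑ c : Fin (n + 1) → Bit, ind (pad c 0 = 1) * sandwich p q (wordA p q (List.ofFn c)) =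
      sandwich p q (A p q 1) := by
  simp only [pad_zero]
  rw [sum_fin_cons]
  simp only [Fin.cons_zero, List.ofFn_cons, wordA, ← Finset.mul_sum]
  rw [sum_ind_mul (fun c => ∑ v : Fin n → Bit, sandwich p q (A p q c * wordA q p (List.ofFn v))),
    ← sandwich_sum, ← Finset.mul_sum]
  change sandwich p q (A p q 1 * wordSum q p n) = _
  rw [sandwich, ← Matrix.mulVec_mulVec, wordSum_mulVec_vecR]
  rfl

/-- An even number of summed bits returns `vecL` to itself, so the mean density at even times does
not depend on time. -/
theorem sum_last_one (p q : ℝ) (j : ℕ) :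
    ∑ c : Fin (2 * j + 1) → Bit,
      ind (pad c (2 * j) = 1) * sandwich p q (wordA p q (List.ofFn c)) =
      sandwich p q (A p q 1) := by
  simp only [pad_last]
  rw [sum_fin_snoc]
  simp only [Fin.snoc_last, ofFn_snoc, wordA_append, List.length_ofFn, even_two_mul, if_true,
    ← Finset.mul_sum, wordA, mul_one]
  rw [sum_ind_mul (fun c => ∑ v : Fin (2 * j) → Bit,
    sandwich p q (wordA p q (List.ofFn v) * A p q c)), ← sandwich_sum, ← Finset.sum_mul]
  change sandwich p q (wordSum p q (2 * j) * A p q 1) = _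
  rw [sandwich, Matrix.dotProduct_mulVec, ← Matrix.vecMul_vecMul, vecL_vecMul_wordSum,
    ← Matrix.dotProduct_mulVec]
  rfl

theorem sum_first_last_one (p q : ℝ) (j : ℕ) :
    ∑ c : Fin (2 * (j + 1) + 1) → Bit, ind (pad c (2 * (j + 1)) = 1) * ind (pad c 0 = 1) *
        sandwich p q (wordA p q (List.ofFn c)) =
      sandwich p q (A p q 1 * (sumA q p * sumA p q) ^ j * sumA q p * A p q 1) := by
  simp only [pad_last, pad_zero]
  change ∑ c : Fin (2 * j + 1 + 1 + 1) → Bit, ind (c (Fin.last (2 * j + 2)) = 1) *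
    ind (c 0 = 1) * sandwich p q (wordA p q (List.ofFn c)) = _
  rw [sum_fin_cons]
  have e1 : ∀ (a : Bit) (v : Fin (2 * j + 2) → Bit),
      (Fin.cons a v : Fin (2 * j + 2 + 1) → Bit) (Fin.last (2 * j + 2)) =
        v (Fin.last (2 * j + 1)) := fun a v => rfl
  simp only [Fin.cons_zero, e1, List.ofFn_cons, wordA]
  have e2 : ∀ a : Bit, ∑ v : Fin (2 * j + 1 + 1) → Bit, ind (v (Fin.last (2 * j + 1)) = 1) *
      ind (a = 1) * sandwich p q (A p q a * wordA q p (List.ofFn v)) =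
      ind (a = 1) * sandwich p q (A p q a * (wordSum q p (2 * j + 1) * A p q 1)) := by
    intro a
    rw [sum_fin_snoc]
    have hodd : ¬ Even (2 * j + 1) := by simp
    simp only [Fin.snoc_last, ofFn_snoc, wordA_append, List.length_ofFn, if_neg hodd, wordA,
      mul_one, mul_assoc (ind _), ← Finset.mul_sum]
    rw [sum_ind_mul (fun c => ind (a = 1) * ∑ v : Fin (2 * j + 1) → Bit,
      sandwich p q (A p q a * (wordA q p (List.ofFn v) * A p q c))), ← sandwich_sum,
      ← Finset.mul_sum, ← Finset.sum_mul]
    rfl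
  rw [Finset.sum_congr rfl fun a _ => e2 a,
    sum_ind_mul (fun a => sandwich p q (A p q a * (wordSum q p (2 * j + 1) * A p q 1))),
    wordSum_odd]
  simp only [mul_assoc]

theorem corr_eq_sandwich {ξ ω x y : ℝ} (hx : 0 < x) (hy : 0 < y)
    (H : ∀ r w, blockProb ξ ω r w = rowProb x y r w) (j : ℕ) :
    corr ξ ω (2 * (j + 1)) =
      sandwich y x (A y x 1 * (sumA x y * sumA y x) ^ j * sumA x y * A y x 1)
        - sandwich y x (A y x 1) ^ 2 := by
  -- The window of `corr` at time `2 * (j + 1)` is one site narrower on each side than that of a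
  -- time-state with `2 * (j + 1) + 1` bits; it suffices because the last bit is at an even time.
  have hk : 2 * (j + 1) ≤ 2 * j + 1 ∨ (2 * (j + 1) = 2 * j + 1 + 1 ∧ Even (2 * (j + 1))) :=
    Or.inr ⟨by ring, by simp⟩
  have h2 := expect_history hx hy H hk
    (fun c => ind (c (2 * (j + 1)) = 1) * ind (c 0 = 1))
    (fun c c' h => by rw [h _ le_rfl, h 0 (Nat.zero_le _)])
  have h1 := expect_history hx hy H hk (fun c => ind (c (2 * (j + 1)) = 1))
    (fun c c' h => by rw [h _ le_rfl])
  have h0 := expect_history hx hy H hk (fun c => ind (c 0 = 1))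
    (fun c c' h => by rw [h 0 (Nat.zero_le _)])
  rw [sum_first_last_one] at h2
  rw [sum_last_one] at h1
  rw [sum_first_one] at h0
  have d0 : ∀ s, density 0 s = ind (evolve s 0 ((0 % 2 : ℕ) : ℤ) = 1) := fun s => density_eq s 0
  have e2 : (fun s => density (2 * (j + 1)) s * density 0 s) = fun s : ℤ → Bit =>
      ind (evolve s (2 * (j + 1)) ((2 * (j + 1) % 2 : ℕ) : ℤ) = 1) *
        ind (evolve s 0 ((0 % 2 : ℕ) : ℤ) = 1) := by
    funext s; rw [density_eq, d0]
  have e1 : density (2 * (j + 1)) = fun s : ℤ → Bit =>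
      ind (evolve s (2 * (j + 1)) ((2 * (j + 1) % 2 : ℕ) : ℤ) = 1) := by
    funext s; rw [density_eq]
  have e0 : density 0 = fun s : ℤ → Bit => ind (evolve s 0 ((0 % 2 : ℕ) : ℤ) = 1) := by
    funext s; rw [d0]
  rw [corr, e2, e1, e0, sq]
  exact congrArg₂ (· - ·) h2 (congrArg₂ (· * ·) h1 h0)

/-! ### Convergence of powers of a positive stochastic matrix -/

/-- Powers of a stochastic matrix that dominates a multiple of its stationary projection converge
to that projection. -/
theorem tendsto_pow_stochastic {ι : Type*} [Fintype ι] [DecidableEq ι] {Q : Matrix ι ι ℝ}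
    {l : ι → ℝ} {ε : ℝ} (hε : 0 < ε) (hε1 : ε < 1) (hQ : Q *ᵥ 1 = 1) (hl : l ᵥ* Q = l)
    (hl1 : l ⬝ᵥ 1 = 1) (hpos : ∀ i j, ε * l j ≤ Q i j) :
    Tendsto (fun n : ℕ => Q ^ n) atTop (𝓝 (Matrix.vecMulVec 1 l)) := by
  set R := Matrix.vecMulVec (1 : ι → ℝ) l with hR
  -- Doeblin's decomposition: `M` is nonnegative with row sums `1 - ε`, and `Q ^ n = M ^ n + (1 - (1
  -- - ε) ^ n) • R`, so the error decays like `(1 - ε) ^ n`.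
  set M := Q - ε • R with hM
  have hRR : R * R = R := by
    rw [hR, Matrix.vecMulVec_mul_vecMulVec, hl1, one_smul]
  have hQR : Q * R = R := by rw [hR, Matrix.mul_vecMulVec, hQ]
  have hRQ : R * Q = R := by rw [hR, Matrix.vecMulVec_mul, hl]
  have hMR : M * R = (1 - ε) • R := by
    rw [hM, sub_mul, Matrix.smul_mul, hQR, hRR, sub_smul, one_smul]
  have hMnR : ∀ n : ℕ, M ^ n * R = (1 - ε) ^ n • R := by
    intro n
    induction n with
    | zero => simp
    | succ n ih => rw [pow_succ, mul_assoc, hMR, Matrix.mul_smul, ih, smul_smul, pow_succ']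
  have hQM : Q = M + ε • R := by rw [hM]; abel
  have hQn : ∀ n : ℕ, Q ^ n = M ^ n + (1 - (1 - ε) ^ n) • R := by
    intro n
    induction n with
    | zero => simp
    | succ n ih =>
      have h1 : M ^ n * Q = M ^ (n + 1) + (ε * (1 - ε) ^ n) • R := by
        conv_lhs => rw [hQM]
        rw [mul_add, ← pow_succ, Matrix.mul_smul, hMnR, smul_smul]
      rw [pow_succ, ih, add_mul, h1, Matrix.smul_mul, hRQ, add_assoc, ← add_smul]
      congr 2
      ring
  have hM0 : ∀ i j, 0 ≤ M i j := by
    intro i j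
    simp only [hM, hR, Matrix.sub_apply, Matrix.smul_apply, Matrix.vecMulVec_apply, smul_eq_mul,
      Pi.one_apply, one_mul]
    linarith [hpos i j]
  have hMn0 : ∀ (n : ℕ) i j, 0 ≤ (M ^ n) i j := by
    intro n
    induction n with
    | zero =>
      intro i j
      rw [pow_zero, Matrix.one_apply]
      split_ifs <;> norm_num
    | succ n ih =>
      intro i j
      rw [pow_succ, Matrix.mul_apply]
      exact Finset.sum_nonneg fun k _ => mul_nonneg (ih i k) (hM0 k j)
  have hM1 : ∀ n : ℕ, M ^ n *ᵥ 1 = (1 - ε) ^ n • (1 : ι → ℝ) := by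
    intro n
    have hR1 : R *ᵥ 1 = 1 := by
      funext i
      simp only [hR, Matrix.mulVec, Matrix.vecMulVec_apply, dotProduct, Pi.one_apply, one_mul,
        mul_one]
      simpa [dotProduct] using hl1
    have h := congrArg (· *ᵥ (1 : ι → ℝ)) (hMnR n)
    simpa only [← Matrix.mulVec_mulVec, Matrix.smul_mulVec, hR1] using h
  have hle : ∀ (n : ℕ) i j, (M ^ n) i j ≤ (1 - ε) ^ n := by
    intro n i j
    have h := congrFun (hM1 n) i
    simp only [Matrix.mulVec, dotProduct, Pi.one_apply, mul_one, Pi.smul_apply,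
      smul_eq_mul] at h
    rw [← h]
    exact Finset.single_le_sum (f := fun k => (M ^ n) i k) (fun k _ => hMn0 n i k)
      (Finset.mem_univ j)
  have hlim : Tendsto (fun n : ℕ => (1 - ε) ^ n) atTop (𝓝 0) :=
    tendsto_pow_atTop_nhds_zero_of_lt_one (by linarith) (by linarith)
  have hMlim : Tendsto (fun n : ℕ => M ^ n) atTop (𝓝 0) := by
    refine tendsto_pi_nhds.2 fun i => tendsto_pi_nhds.2 fun j => ?_
    exact squeeze_zero (fun n => hMn0 n i j) (fun n => hle n i j) hlim
  have h := hMlim.add (((tendsto_const_nhds (x := (1 : ℝ))).sub hlim).smul_const R)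
  simp only [sub_zero, one_smul, zero_add] at h
  exact h.congr fun n => (hQn n).symm

/-! ### The stationary state as a limit of finite rings -/

/-- The stochastic matrix `P_0 + P_1`. -/
def sumP (x y : ℝ) : Matrix (Fin 3) (Fin 3) ℝ := P x y 0 + P x y 1

/-- The diagonal matrix that relates `W_s` to `P_s`. -/
noncomputable def scaling (x y : ℝ) : Matrix (Fin 3) (Fin 3) ℝ :=
  Matrix.diagonal ![1, (1 - y) / (1 - x), (1 - x) / (1 - y)]

theorem scaling_mul_scaling {x y : ℝ} (hx : x < 1) (hy : y < 1) :
    scaling x y * scaling y x = 1 := by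
  have h1 : 1 - x ≠ 0 := by linarith
  have h2 : 1 - y ≠ 0 := by linarith
  rw [scaling, scaling, Matrix.diagonal_mul_diagonal, ← Matrix.diagonal_one]
  congr 1
  funext i
  fin_cases i <;> simp [h1, h2]

theorem W_eq {x y ξ ω : ℝ} (hx : x < 1) (hy : y < 1) (hξ : ξ = x * (1 - y) / (1 - x) ^ 2)
    (hω : ω = y * (1 - x) / (1 - y) ^ 2) (s : Bit) :
    W ξ ω s = (1 - x)⁻¹ • (scaling x y * P x y s * scaling x y) := by
  have h1 : 1 - x ≠ 0 := by linarith
  have h2 : 1 - y ≠ 0 := by linarith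
  ext i j
  rw [Matrix.smul_apply, scaling, Matrix.mul_diagonal, Matrix.diagonal_mul, smul_eq_mul]
  rcases bit_cases s with rfl | rfl <;> fin_cases i <;> fin_cases j <;>
    simp [W, P, hξ, hω] <;> field_simp

/-- The relation between the parameters and the filling probabilities. -/
structure IsFilling (ξ ω x y : ℝ) : Prop where
  x_pos : 0 < x
  x_lt : x < 1
  y_pos : 0 < y
  y_lt : y < 1
  xi_eq : ξ = x * (1 - y) / (1 - x) ^ 2
  omega_eq : ω = y * (1 - x) / (1 - y) ^ 2

theorem IsFilling.symm {ξ ω x y : ℝ} (h : IsFilling ξ ω x y) : IsFilling ω ξ y x :=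
  ⟨h.y_pos, h.y_lt, h.x_pos, h.x_lt, h.omega_eq, h.xi_eq⟩

/-- In terms of the odds `a = x / (1 - x)` and `b = y / (1 - y)`, the relations read `ξ (1 + b) = a
(1 + a)` and `ω (1 + a) = b (1 + b)`. Multiplying them gives `a b = ξ ω`, and eliminating `b` leaves
a cubic for `a` that is negative at 0 and nonnegative at the right end of the interval. -/
theorem exists_isFilling {ξ ω : ℝ} (hξ : 0 < ξ) (hω : 0 < ω) :
    ∃ x y, IsFilling ξ ω x y := by
  have hc : ContinuousOn (fun t : ℝ => t ^ 3 + t ^ 2 - ξ * t - ξ ^ 2 * ω)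
      (Set.Icc 0 (1 + ξ + ξ ^ 2 * ω)) := by fun_prop
  have hk : 0 < ξ ^ 2 * ω := by positivity
  obtain ⟨a, ⟨ha0, -⟩, ha⟩ := intermediate_value_Icc (by positivity) hc
    (show (0 : ℝ) ∈ Set.Icc _ _ by
      constructor
      · simpa using hk.le
      · generalize ξ ^ 2 * ω = k at *
        have : 0 ≤ (1 + ξ + k) ^ 3 + (1 + ξ + k) ^ 2 - ξ * (1 + ξ + k) - k := by
          nlinarith [mul_pos hξ hk, mul_pos hξ hξ, mul_pos hk hk, pow_pos hξ 3, pow_pos hk 3,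
            mul_pos (mul_pos hξ hk) hξ, mul_pos (mul_pos hξ hk) hk]
        exact this)
  have ha' : 0 < a := by
    rcases ha0.lt_or_eq with h | h
    · exact h
    · simp only [← h] at ha
      nlinarith
  have hb' : 0 < ξ * ω / a := by positivity
  set b := ξ * ω / a with hb
  have hab : a * b = ξ * ω := by rw [hb]; field_simp
  have h1 : ξ * (1 + b) = a * (1 + a) := by
    have : a * (ξ * (1 + b)) = a * (a * (1 + a)) := by
      simp only at ha
      linear_combination ξ * hab - ha
    exact mul_left_cancel₀ ha'.ne' this
  have h2 : ω * (1 + a) = b * (1 + b) := by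
    have : a * (ω * (1 + a)) = a * (b * (1 + b)) := by
      linear_combination (-ω) * h1 - (1 + b) * hab
    exact mul_left_cancel₀ ha'.ne' this
  refine ⟨a / (1 + a), b / (1 + b), by positivity, ?_, by positivity, ?_, ?_, ?_⟩
  · rw [div_lt_one (by positivity)]; linarith
  · rw [div_lt_one (by positivity)]; linarith
  · rw [show 1 - a / (1 + a) = 1 / (1 + a) by field_simp; ring,
      show 1 - b / (1 + b) = 1 / (1 + b) by field_simp; ring]
    field_simp
    linarith
  · rw [show 1 - a / (1 + a) = 1 / (1 + a) by field_simp; ring,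
      show 1 - b / (1 + b) = 1 / (1 + b) by field_simp; ring]
    field_simp
    linarith

theorem sumP_mulVec_one (x y : ℝ) : sumP x y *ᵥ 1 = 1 := by
  funext i
  fin_cases i <;>
    simp [sumP, P, Matrix.mulVec, dotProduct, Fin.sum_univ_three, Matrix.add_apply]

theorem statRow_vecMul_sumP (x y : ℝ) : statRow x y ᵥ* sumP x y = statRow y x := by
  simp only [statRow, Matrix.smul_vecMul, add_right_comm 1 y x]
  congr 1
  funext i
  fin_cases i <;>
    simp [sumP, P, Matrix.vecMul, dotProduct, Fin.sum_univ_three, Matrix.add_apply] <;> ring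

theorem statRow_dotProduct_one {x y : ℝ} (hx : 0 < x) (hy : 0 < y) :
    statRow x y ⬝ᵥ 1 = 1 := by
  have : 1 + x + y ≠ 0 := by positivity
  simp [statRow, dotProduct, Fin.sum_univ_three]
  field_simp
  ring

theorem tendsto_sumP_pow {ξ ω x y : ℝ} (h : IsFilling ξ ω x y) :
    Tendsto (fun n : ℕ => (sumP x y * sumP y x) ^ n) atTop
      (𝓝 (Matrix.vecMulVec 1 (statRow x y))) := by
  obtain ⟨hx, hx1, hy, hy1, -, -⟩ := h
  have hN : 0 < 1 + x + y := by positivity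
  have hu : 0 < 1 - x := by linarith
  have hv : 0 < 1 - y := by linarith
  have hle : ∀ a b c d : ℝ, 0 < a → 0 < b → 0 < c → 0 < d → c < 1 → d < 1 →
      a * b * (c * d) ≤ a * b := by
    intro a b c d ha hb hc hd hc1 hd1
    have : c * d ≤ 1 := by nlinarith
    have hab : 0 < a * b := by positivity
    nlinarith
  have q1 := hle (1 - x) (1 - y) x y hu hv hx hy hx1 hy1
  have q2 := hle (1 - x) y x (1 - y) hu hy hx hv hx1 (by linarith)
  have q3 := hle x (1 - y) (1 - x) y hx hv hu hy (by linarith) hy1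
  have q4 := hle x y (1 - x) (1 - y) hx hy hu hv (by linarith) (by linarith)
  have q5 := hle x (1 - x) y (1 - y) hx hu hy hv hy1 (by linarith)
  have q6 := hle y (1 - y) x (1 - x) hy hv hx hu hx1 (by linarith)
  have p1 : 0 < x * y := by positivity
  have p2 : 0 < (1 - x) * (1 - x) := by positivity
  have p3 : 0 < (1 - y) * (1 - y) := by positivity
  -- A common lower bound for all nine entries of the two-step matrix; a single factor `sumP` has
  -- zero entries.
  have hε : 0 < x * y * ((1 - x) * (1 - y)) := by positivity
  refine tendsto_pow_stochastic hε ?_ ?_ ?_ (statRow_dotProduct_one hx hy) ?_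
  · nlinarith
  · rw [← Matrix.mulVec_mulVec, sumP_mulVec_one, sumP_mulVec_one]
  · rw [← Matrix.vecMul_vecMul, statRow_vecMul_sumP, statRow_vecMul_sumP]
  · intro i j
    have hl : statRow x y j ≤ 1 := by
      fin_cases j <;> simp [statRow] <;> field_simp <;> linarith
    have hQ : x * y * ((1 - x) * (1 - y)) ≤ (sumP x y * sumP y x) i j := by
      fin_cases i <;> fin_cases j <;>
        simp [sumP, P, Matrix.mul_apply, Fin.sum_univ_three] <;> linarith
    nlinarith

/-- The diagonal matrices for the two rows are inverse to each other, so they cancel between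
neighbouring letters; the outer two cancel later under the trace. -/
theorem word_scaling {ξ ω x y : ℝ} (h : IsFilling ξ ω x y) : ∀ w : List Bit,
    wordW ξ ω w * (if Even w.length then 1 else W ω ξ 0 + W ω ξ 1) =
      ((1 - x)⁻¹ * (1 - y)⁻¹) ^ ((w.length + 1) / 2) • (scaling x y *
        (wordP x y w * (if Even w.length then 1 else sumP y x)) * scaling y x)
  | [] => by simp [wordW, wordP, scaling_mul_scaling h.x_lt h.y_lt]
  | [s] => by
    have e := scaling_mul_scaling h.x_lt h.y_lt
    have hs : W ω ξ 0 + W ω ξ 1 = (1 - y)⁻¹ • (scaling y x * sumP y x * scaling y x) := by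
      rw [W_eq h.y_lt h.x_lt h.omega_eq h.xi_eq, W_eq h.y_lt h.x_lt h.omega_eq h.xi_eq, sumP,
        mul_add, add_mul, smul_add]
    simp only [wordW, wordP, mul_one, List.length_singleton, hs, W_eq h.x_lt h.y_lt h.xi_eq
      h.omega_eq, if_neg Nat.not_even_one, Matrix.smul_mul, Matrix.mul_smul, smul_smul]
    rw [show (1 + 1) / 2 = 1 from rfl, pow_one]
    congr 1
    · ring
    · simp only [mul_assoc]
      rw [← mul_assoc (scaling x y) (scaling y x), e, one_mul]
  | s :: s' :: w => by
    have ih := word_scaling h w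
    have e := scaling_mul_scaling h.x_lt h.y_lt
    have e' := scaling_mul_scaling h.y_lt h.x_lt
    have hev : Even (s :: s' :: w).length ↔ Even w.length := by
      simp [Nat.even_add_one]
    have hl : ((s :: s' :: w).length + 1) / 2 = (w.length + 1) / 2 + 1 := by
      simp only [List.length_cons]; omega
    simp only [hev, hl, wordW, wordP, mul_assoc]
    simp only [mul_assoc] at ih
    rw [ih, W_eq h.x_lt h.y_lt h.xi_eq h.omega_eq, W_eq h.y_lt h.x_lt h.omega_eq h.xi_eq]
    simp only [Matrix.smul_mul, Matrix.mul_smul, smul_smul]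
    congr 1
    · ring
    · simp only [mul_assoc]
      rw [← mul_assoc (scaling y x) (scaling x y), e', one_mul,
        ← mul_assoc (scaling x y) (scaling y x), e, one_mul]

theorem T_pow_eq {ξ ω x y : ℝ} (h : IsFilling ξ ω x y) (n : ℕ) :
    T ξ ω ^ n = ((1 - x)⁻¹ * (1 - y)⁻¹) ^ n •
      (scaling x y * (sumP x y * sumP y x) ^ n * scaling y x) := by
  have e := scaling_mul_scaling h.x_lt h.y_lt
  have e' := scaling_mul_scaling h.y_lt h.x_lt
  have hT : T ξ ω = ((1 - x)⁻¹ * (1 - y)⁻¹) •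
      (scaling x y * (sumP x y * sumP y x) * scaling y x) := by
    have h0 := word_scaling h [0]
    have h1 := word_scaling h [1]
    simp only [List.length_singleton, if_neg Nat.not_even_one, wordW, wordP, mul_one] at h0 h1
    rw [T, add_mul, h0, h1, ← smul_add, ← add_mul, ← mul_add, ← add_mul]
    simp only [Nat.reduceAdd, Nat.reduceDiv, pow_one]
    rfl
  induction n with
  | zero => simp [e]
  | succ n ih =>
    rw [pow_succ, ih, hT, pow_succ, pow_succ]
    simp only [Matrix.smul_mul, Matrix.mul_smul, smul_smul]
    rw [mul_comm ((1 - x)⁻¹ * (1 - y)⁻¹)]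
    congr 1
    simp only [mul_assoc]
    rw [← mul_assoc (scaling y x) (scaling x y), e', one_mul]

theorem ringWeight_eq {ξ ω x y : ℝ} (h : IsFilling ξ ω x y) (w : List Bit) {N : ℕ}
    (hN : (w.length + 1) / 2 ≤ N) :
    ringWeight ξ ω N w = ((1 - x)⁻¹ * (1 - y)⁻¹) ^ N *
      ((wordP x y w * (if Even w.length then 1 else sumP y x)) *
        (sumP x y * sumP y x) ^ (N - (w.length + 1) / 2)).trace := by
  have e' := scaling_mul_scaling h.y_lt h.x_lt
  rw [ringWeight, word_scaling h, T_pow_eq h]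
  simp only [Matrix.smul_mul, Matrix.mul_smul, smul_smul, Matrix.trace_smul, smul_eq_mul]
  rw [← pow_add, Nat.sub_add_cancel hN]
  congr 1
  rw [mul_assoc (scaling x y), mul_assoc (scaling x y), Matrix.trace_mul_comm]
  simp only [mul_assoc]
  rw [e', mul_one, ← mul_assoc (scaling y x) (scaling x y), e', one_mul]

theorem tendsto_ringWeight {ξ ω x y : ℝ} (h : IsFilling ξ ω x y) (w : List Bit) :
    Tendsto (fun N : ℕ => ringWeight ξ ω N w / (T ξ ω ^ N).trace) atTop
      (𝓝 (statProb x y w)) := by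
  set c := (1 - x)⁻¹ * (1 - y)⁻¹ with hc
  have hc0 : c ≠ 0 := by
    have h1 : 1 - x ≠ 0 := by linarith [h.x_lt]
    have h2 : 1 - y ≠ 0 := by linarith [h.y_lt]
    positivity
  set Q := sumP x y * sumP y x
  set M := wordP x y w * (if Even w.length then 1 else sumP y x) with hM
  have hl1 := statRow_dotProduct_one h.x_pos h.y_pos
  have hlim := tendsto_sumP_pow h
  have htr : ∀ B : Matrix (Fin 3) (Fin 3) ℝ,
      (B * Matrix.vecMulVec 1 (statRow x y)).trace = statRow x y ⬝ᵥ (B *ᵥ 1) := by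
    intro B
    rw [Matrix.mul_vecMulVec, Matrix.trace_vecMulVec, dotProduct_comm]
  have hcont : ∀ B : Matrix (Fin 3) (Fin 3) ℝ,
      Continuous fun X : Matrix (Fin 3) (Fin 3) ℝ => (B * X).trace := fun B =>
    (continuous_const.matrix_mul continuous_id).matrix_trace
  have hnum : Tendsto (fun N : ℕ => (M * Q ^ (N - (w.length + 1) / 2)).trace) atTop
      (𝓝 (statProb x y w)) := by
    have h1 := ((hcont M).tendsto _).comp (hlim.comp (tendsto_sub_atTop_nat ((w.length + 1) / 2)))
    have h2 : M *ᵥ 1 = wordP x y w *ᵥ vecR := by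
      have hv : (1 : Fin 3 → ℝ) = vecR := by
        funext i; fin_cases i <;> rfl
      rw [hM]
      split_ifs
      · rw [mul_one, hv]
      · rw [← Matrix.mulVec_mulVec, sumP_mulVec_one, hv]
    rw [htr, h2] at h1
    exact h1
  have hden : Tendsto (fun N : ℕ => (Q ^ N).trace) atTop (𝓝 1) := by
    have h1 := ((hcont 1).tendsto _).comp hlim
    rw [htr, Matrix.one_mulVec, hl1] at h1
    simpa [Function.comp_def] using h1
  have hquot := hnum.div hden one_ne_zero
  rw [div_one] at hquot
  refine hquot.congr' ?_
  filter_upwards [eventually_ge_atTop ((w.length + 1) / 2)] with N hN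
  have hT : (T ξ ω ^ N).trace = c ^ N * (Q ^ N).trace := by
    have := ringWeight_eq h [] (N := N) (by simp)
    simpa [ringWeight, wordW, wordP] using this
  rw [ringWeight_eq h w hN, hT, mul_div_mul_left _ _ (pow_ne_zero N hc0)]
  rfl

theorem tendsto_ringProb {ξ ω x y : ℝ} (h : IsFilling ξ ω x y) (r : Row) (w : List Bit) :
    Tendsto (fun N : ℕ => ringProb ξ ω r N w) atTop (𝓝 (rowProb x y r w)) := by
  cases r with
  | lower => exact tendsto_ringWeight h w
  | upper =>
    have hT : ∀ N : ℕ, (T ω ξ ^ N).trace = (T ξ ω ^ N).trace := by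
      intro N
      have h1 : ∀ {ξ ω x y : ℝ}, IsFilling ξ ω x y → (T ξ ω ^ N).trace =
          ((1 - x)⁻¹ * (1 - y)⁻¹) ^ N * ((sumP x y * sumP y x) ^ N).trace := by
        intro ξ ω x y h
        have := ringWeight_eq h [] (N := N) (by simp)
        simpa [ringWeight, wordW, wordP] using this
      -- Cyclicity of the trace: the normalisation does not depend on the row of the first letter.
      have h2 : ((sumP x y * sumP y x) ^ N).trace = ((sumP y x * sumP x y) ^ N).trace := by
        cases N with
        | zero => simp
        | succ N =>
          have hsc : SemiconjBy (sumP y x) (sumP x y * sumP y x) (sumP y x * sumP x y) := by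
            simp [SemiconjBy, mul_assoc]
          rw [pow_succ, ← mul_assoc, Matrix.trace_mul_comm, ← mul_assoc, (hsc.pow_right N).eq,
            mul_assoc, ← pow_succ]
      rw [h1 h, h1 h.symm, h2, mul_comm (1 - x)⁻¹]
    refine (tendsto_ringWeight h.symm w).congr fun N => ?_
    rw [hT]
    rfl

theorem blockProb_eq {ξ ω x y : ℝ} (h : IsFilling ξ ω x y) (r : Row) (w : List Bit) :
    blockProb ξ ω r w = rowProb x y r w :=
  (tendsto_ringProb h r w).limUnder_eq

/-! ### Filling probabilities -/

theorem filling_ratios {ξ ω x y : ℝ} (h : IsFilling ξ ω x y) :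
    leftFilling ξ ω = x ∧ rightFilling ξ ω = y ∧
      blockProb ξ ω .lower [0, 1, 0] / blockProb ξ ω .lower [0, 1] = x ∧
      blockProb ξ ω .lower [0, 1, 0] / blockProb ξ ω .upper [1, 0] = y := by
  have hx := h.x_pos
  have hy := h.y_pos
  have hx1 : 1 - x ≠ 0 := by linarith [h.x_lt]
  have hy1 : 1 - y ≠ 0 := by linarith [h.y_lt]
  have hN : 1 + x + y ≠ 0 := by positivity
  have hN' : 1 + y + x ≠ 0 := by positivity
  have e00 : statProb x y [0, 0] = (1 - y) / (1 + x + y) := by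
    simp [statProb, wordP, P, statRow, vecR, Matrix.mulVec, dotProduct, Fin.sum_univ_three,
      Matrix.mul_apply]
    field_simp
    ring
  have e00' : statProb y x [0, 0] = (1 - x) / (1 + x + y) := by
    simp [statProb, wordP, P, statRow, vecR, Matrix.mulVec, dotProduct, Fin.sum_univ_three,
      Matrix.mul_apply]
    field_simp
    ring
  have e001 : statProb x y [0, 0, 1] = x * (1 - y) / (1 + x + y) := by
    simp [statProb, wordP, P, statRow, vecR, Matrix.mulVec, dotProduct, Fin.sum_univ_three,
      Matrix.mul_apply]
    field_simp
    ring
  have e100 : statProb x y [1, 0, 0] = y * (1 - x) / (1 + x + y) := by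
    simp [statProb, wordP, P, statRow, vecR, Matrix.mulVec, dotProduct, Fin.sum_univ_three,
      Matrix.mul_apply]
    field_simp
    ring
  have e010 : statProb x y [0, 1, 0] = x * y / (1 + x + y) := by
    simp [statProb, wordP, P, statRow, vecR, Matrix.mulVec, dotProduct, Fin.sum_univ_three,
      Matrix.mul_apply]
    field_simp
    ring
  have e01 : statProb x y [0, 1] = y / (1 + x + y) := by
    simp [statProb, wordP, P, statRow, vecR, Matrix.mulVec, dotProduct, Fin.sum_univ_three,
      Matrix.mul_apply]
    field_simp
    ring
  have e10 : statProb y x [1, 0] = x / (1 + x + y) := by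
    simp [statProb, wordP, P, statRow, vecR, Matrix.mulVec, dotProduct, Fin.sum_univ_three,
      Matrix.mul_apply]
    field_simp
    ring
  simp only [leftFilling, rightFilling, blockProb_eq h, rowProb, e00, e00', e001, e100, e010, e01,
    e10]
  refine ⟨?_, ?_, ?_, ?_⟩ <;> field_simp

/-! ### Closed form of the one-site correlations -/

/-- The second-order recursion obeyed by the powers of two numbers with sum `-s` and product `p`. -/
structure IsLucas (s p : ℂ) (h : ℕ → ℂ) : Prop where
  zero : h 0 = 0
  one : h 1 = 1
  step : ∀ k, h (k + 2) = -s * h (k + 1) - p * h k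

theorem isLucas_of_ne {s p Λ₁ Λ₂ : ℂ} (hs : Λ₁ + Λ₂ = -s) (hp : Λ₁ * Λ₂ = p) (hne : Λ₁ ≠ Λ₂) :
    IsLucas s p fun k => (Λ₁ ^ k - Λ₂ ^ k) / (Λ₁ - Λ₂) := by
  have h : Λ₁ - Λ₂ ≠ 0 := sub_ne_zero.2 hne
  refine ⟨by simp, by simp [h], fun k => ?_⟩
  rw [← hs, ← hp]
  field_simp
  ring

theorem isLucas_of_eq {s p Λ : ℂ} (hs : Λ + Λ = -s) (hp : Λ * Λ = p) :
    IsLucas s p fun k => (k : ℂ) * Λ ^ (k - 1) := by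
  refine ⟨by simp, by simp, fun k => ?_⟩
  rw [← hs, ← hp]
  -- At `k = 0` the truncated exponent `k - 1` occurs with the coefficient 0; for larger `k` the
  -- subtraction is genuine.
  cases k with
  | zero => simp; ring
  | succ k =>
    simp only [show k + 1 + 2 - 1 = k + 2 by omega, show k + 1 + 1 - 1 = k + 1 by omega,
      show k + 1 - 1 = k by omega]
    push_cast
    ring

theorem sumA_apply (p q : ℝ) : sumA p q = !![1 - p, p, 0; 0, 0, 1; 1, 0, 0] := by
  ext i j
  fin_cases i <;> fin_cases j <;> simp [sumA, A]

theorem sumA_mul_sumA (x y : ℝ) : sumA x y * sumA y x =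
    !![(1 - x) * (1 - y), (1 - x) * y, x; 1, 0, 0; 1 - y, y, 0] := by
  rw [sumA_apply, sumA_apply]
  ext i j
  fin_cases i <;> fin_cases j <;> simp [Matrix.mul_apply, Fin.sum_univ_three]

/-- The polynomial `z² + s z + p` with `s = x + y - x y`, `p = x y` accounts for the two eigenvalues
other than 1. It leaves only the stationary projection, with coefficient its value `1 + s + p = 1 +
x + y` at `z = 1`. -/
theorem sumA_quadratic {x y : ℝ} (hx : 0 < x) (hy : 0 < y) :
    (sumA x y * sumA y x) ^ 2 + (x + y - x * y) • (sumA x y * sumA y x) +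
      (x * y) • (1 : Matrix (Fin 3) (Fin 3) ℝ) =
    (1 + x + y) • Matrix.vecMulVec vecR (vecL x y) := by
  have hN : 1 + x + y ≠ 0 := by positivity
  rw [sumA_mul_sumA, sq]
  ext i j
  fin_cases i <;> fin_cases j <;>
    simp [vecR, vecL, hN] <;> ring

/-- The one-site correlation function as a matrix element. -/
noncomputable def corrElement (x y : ℝ) (j : ℕ) : ℝ :=
  sandwich y x (A y x 1 * (sumA x y * sumA y x) ^ j * sumA x y * A y x 1)
    - sandwich y x (A y x 1) ^ 2

theorem sandwich_A_one (x y : ℝ) : sandwich y x (A y x 1) = (x + y) / (1 + x + y) := by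
  simp [sandwich, vecL, A, vecR, Matrix.mulVec, dotProduct, Fin.sum_univ_three,
    add_right_comm 1 y x]
  ring

theorem corrElement_zero {x y : ℝ} (hx : 0 < x) (hy : 0 < y) :
    corrElement x y 0 = -((x + y) ^ 2 - x * y * (1 + x + y)) / (1 + x + y) ^ 2 := by
  have hN : 1 + x + y ≠ 0 := by positivity
  rw [corrElement, sandwich_A_one, pow_zero, mul_one, sumA_apply]
  simp [sandwich, vecL, A, vecR, Matrix.mulVec, dotProduct, Fin.sum_univ_three, Matrix.mul_apply,
    add_right_comm 1 y x]
  field_simp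

theorem corrElement_one {x y : ℝ} (hx : 0 < x) (hy : 0 < y) :
    corrElement x y 1 = -(-(x + y - x * y) * ((x + y) ^ 2 - x * y * (1 + x + y)) +
      x * y * (x + y)) / (1 + x + y) ^ 2 := by
  have hN : 1 + x + y ≠ 0 := by positivity
  rw [corrElement, sandwich_A_one, pow_one, sumA_mul_sumA, sumA_apply]
  simp [sandwich, vecL, A, vecR, Matrix.mulVec, dotProduct, Fin.sum_univ_three, Matrix.mul_apply,
    add_right_comm 1 y x]
  field_simp
  ring

/-- Between the two density insertions the stationary projection gives the squared mean density, so
the inhomogeneous term is exactly cancelled by the disconnected part. -/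
theorem corrElement_step {x y : ℝ} (hx : 0 < x) (hy : 0 < y) (j : ℕ) :
    corrElement x y (j + 2) =
      -(x + y - x * y) * corrElement x y (j + 1) - x * y * corrElement x y j := by
  set M := sumA x y * sumA y x with hM
  set κ := sandwich y x (A y x 1) with hκ
  have hMR : ∀ n : ℕ, M ^ n *ᵥ vecR = vecR := by
    intro n
    induction n with
    | zero => simp
    | succ n ih => rw [pow_succ, ← Matrix.mulVec_mulVec, hM, ← Matrix.mulVec_mulVec,
        sumA_mulVec_vecR, sumA_mulVec_vecR, ← hM, ih]
  have hquad : M ^ (j + 2) + (x + y - x * y) • M ^ (j + 1) + (x * y) • M ^ j =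
      (1 + x + y) • Matrix.vecMulVec vecR (vecL x y) := by
    have h := congrArg (M ^ j * ·) (sumA_quadratic hx hy)
    simp only [← hM, mul_add, Matrix.mul_smul, mul_one, Matrix.mul_vecMulVec, hMR] at h
    rw [← h, pow_add, ← pow_succ]
  have hlin : ∀ n, corrElement x y n =
      (vecL y x ᵥ* A y x 1) ⬝ᵥ (M ^ n *ᵥ (sumA x y *ᵥ (A y x 1 *ᵥ vecR))) - κ ^ 2 := by
    intro n
    rw [corrElement, sandwich]
    simp only [← Matrix.mulVec_mulVec, Matrix.dotProduct_mulVec]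
    rfl
  have h := congrArg (fun B => (vecL y x ᵥ* A y x 1) ⬝ᵥ
    (B *ᵥ (sumA x y *ᵥ (A y x 1 *ᵥ vecR)))) hquad
  have h1 : (vecL y x ᵥ* A y x 1) ⬝ᵥ (Matrix.vecMulVec vecR (vecL x y) *ᵥ
      (sumA x y *ᵥ (A y x 1 *ᵥ vecR))) = κ * κ := by
    rw [Matrix.vecMulVec_mulVec, Matrix.dotProduct_mulVec (vecL x y), vecL_vecMul_sumA]
    simp only [hκ, sandwich, Matrix.dotProduct_mulVec, dotProduct_smul,
      MulOpposite.smul_eq_mul_unop, MulOpposite.unop_op]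
  simp only [Matrix.add_mulVec, Matrix.smul_mulVec, dotProduct_add, dotProduct_smul,
    smul_eq_mul, h1] at h
  rw [hlin, hlin, hlin]
  linear_combination h

/-- Both sides satisfy the same linear recursion, so agreement at `j = 0, 1` suffices. Working with
any `IsLucas` sequence covers distinct and equal roots at once. -/
theorem corrElement_eq {x y : ℝ} (hx : 0 < x) (hy : 0 < y) {h : ℕ → ℂ}
    (hL : IsLucas ((x : ℂ) + y - x * y) (x * y) h) (j : ℕ) :
    (corrElement x y j : ℂ) =
      -(h (j + 1) * (((x : ℂ) + y) ^ 2 - x * y * (1 + x + y)) +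
        h j * (x * y * ((x : ℂ) + y))) / (1 + (x : ℂ) + y) ^ 2 := by
  have hN : (1 + (x : ℂ) + y) ≠ 0 := by
    have : 1 + x + y ≠ 0 := by positivity
    exact_mod_cast this
  have h2 := hL.step 0
  rw [zero_add, hL.zero, hL.one] at h2
  induction j using Nat.twoStepInduction with
  | zero =>
    rw [corrElement_zero hx hy, zero_add, hL.zero, hL.one]
    push_cast
    ring
  | one =>
    rw [corrElement_one hx hy, hL.one, h2]
    push_cast
    ring
  | more j ih1 ih2 =>
    rw [corrElement_step hx hy]
    push_cast
    rw [ih1, ih2, hL.step (j + 1), hL.step j]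
    field_simp
    ring

/-- With `s`, `p` the coefficients, `0 < p < 1` and `0 < s < 1 + p`. A non-real root has squared
modulus `p`. For a real root with `|z| ≥ 1`, the inequality `(|z| - 1)(|z| - p) ≥ 0` contradicts
`|z|² - s |z| + p ≤ 0`. -/
theorem norm_lt_one_of_quadratic {x y : ℝ} (hx : 0 < x) (hx1 : x < 1) (hy : 0 < y) (hy1 : y < 1)
    {z : ℂ} (hz : z ^ 2 + ((x : ℂ) + y - x * y) * z + x * y = 0) : ‖z‖ < 1 := by
  have hre : z.re ^ 2 - z.im ^ 2 + (x + y - x * y) * z.re + x * y = 0 := by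
    have := congrArg Complex.re hz
    simp [sq] at this
    linarith
  have him : 2 * z.re * z.im + (x + y - x * y) * z.im = 0 := by
    have := congrArg Complex.im hz
    simp [sq] at this
    linarith
  have hp : 0 < x * y := by positivity
  have hp1 : x * y < 1 := by nlinarith
  have hs : 0 < 1 + x * y - (x + y - x * y) := by nlinarith [mul_pos (sub_pos.2 hx1) (sub_pos.2 hy1)]
  have hs0 : 0 < x + y - x * y := by nlinarith
  have key : z.re ^ 2 + z.im ^ 2 < 1 := by
    by_cases h0 : z.im = 0
    · rw [h0] at hre ⊢
      by_contra hcon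
      have hge : 1 ≤ |z.re| := by
        rw [← sq_le_sq₀ zero_le_one (abs_nonneg _), sq_abs]
        linarith
      have h1 : |z.re| ^ 2 - (x + y - x * y) * |z.re| + x * y ≤ 0 := by
        rw [sq_abs]
        nlinarith [neg_abs_le z.re]
      nlinarith [mul_nonneg (sub_nonneg.2 hge) (show 0 ≤ |z.re| - x * y by linarith)]
    · have h1 : 2 * z.re + (x + y - x * y) = 0 := by
        have : (2 * z.re + (x + y - x * y)) * z.im = 0 := by linarith
        exact (mul_eq_zero.1 this).resolve_right h0
      nlinarith
  rw [← sq_lt_one_iff₀ (norm_nonneg z), Complex.sq_norm, Complex.normSq_apply]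
  nlinarith

theorem charpoly_sumA (x y : ℝ) {Λ₁ Λ₂ : ℂ} (hs : Λ₁ + Λ₂ = -((x : ℂ) + y - x * y))
    (hp : Λ₁ * Λ₂ = x * y) :
    ((sumA x y * sumA y x).map (fun r : ℝ => (r : ℂ))).charpoly =
      (Polynomial.X - Polynomial.C 1) * (Polynomial.X - Polynomial.C Λ₁) *
        (Polynomial.X - Polynomial.C Λ₂) := by
  have hs' := congrArg Polynomial.C hs
  have hp' := congrArg Polynomial.C hp
  simp only [Polynomial.C_add, Polynomial.C_neg, Polynomial.C_sub, Polynomial.C_mul] at hs' hp'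
  rw [sumA_mul_sumA, Matrix.charpoly, Matrix.det_fin_three]
  simp
  linear_combination (Polynomial.X * (Polynomial.X - 1)) * hs' - (Polynomial.X - 1) * hp'

end Rule54

open Rule54
theorem mainTheorem4 (ξ ω : ℝ) (hξ : 0 < ξ) (hω : 0 < ω) (pl pr : ℝ)
    (hpl : pl = leftFilling ξ ω) (hpr : pr = rightFilling ξ ω) :
    -- the asymptotic block probabilities exist as limits
    (∀ (r : Row) (w : List Bit),
      Tendsto (fun N : ℕ => ringProb ξ ω r N w) atTop (𝓝 (blockProb ξ ω r w))) ∧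
    -- the filling probabilities
    (0 < pl ∧ pl < 1 ∧ 0 < pr ∧ pr < 1 ∧
      pl = blockProb ξ ω .lower [0, 1, 0] / blockProb ξ ω .lower [0, 1] ∧
      pr = blockProb ξ ω .lower [0, 1, 0] / blockProb ξ ω .upper [1, 0] ∧
      ξ = pl * (1 - pr) / (1 - pl) ^ 2 ∧ ω = pr * (1 - pl) / (1 - pr) ^ 2) ∧
    -- the time-state is a probability distribution, positive exactly on accessible configurations
    (∀ m : ℕ, (∀ b : Fin m → Bit, 0 ≤ timeState ξ ω m b) ∧
      ∑ b : Fin m → Bit, timeState ξ ω m b = 1 ∧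
      ∀ b : Fin m → Bit, timeState ξ ω m b ≠ 0 ↔ Accessible b) ∧
    -- conditional probabilities depend on the last four bits only
    (∀ (k : ℕ) (b : Fin (k + 4) → Bit),
      timeState ξ ω (k + 3) (fun i => b i.castSucc) ≠ 0 →
      timeState ξ ω (k + 4) b / timeState ξ ω (k + 3) (fun i => b i.castSucc) =
        condProb (if Even (k + 3) then pr else pl)
          (b ⟨k, by omega⟩) (b ⟨k + 1, by omega⟩) (b ⟨k + 2, by omega⟩) (b ⟨k + 3, by omega⟩)) ∧
    -- the matrix product form
    (∀ (m : ℕ) (b : Fin m → Bit),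
      timeState ξ ω m b = sandwich pr pl (wordA pr pl (List.ofFn b))) ∧
    -- the one-site correlation function at time `2 * k`, as a matrix element
    (∀ k : ℕ, 1 ≤ k → corr ξ ω (2 * k) =
      sandwich pr pl (A pr pl 1 * (sumA pl pr * sumA pr pl) ^ (k - 1) * sumA pl pr * A pr pl 1)
        - sandwich pr pl (A pr pl 1) ^ 2) ∧
    -- and in closed form, in terms of the subleading eigenvalues of the transfer matrix
    (∀ δ Λ₁ Λ₂ : ℂ,
      δ ^ 2 = ((pl : ℂ) + pr - pl * pr) ^ 2 - 4 * pl * pr →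
      Λ₁ = -(1 / 2) * ((pl : ℂ) + pr - pl * pr + δ) →
      Λ₂ = -(1 / 2) * ((pl : ℂ) + pr - pl * pr - δ) →
      ((sumA pl pr * sumA pr pl).map (fun x : ℝ => (x : ℂ))).charpoly =
        (Polynomial.X - Polynomial.C 1) * (Polynomial.X - Polynomial.C Λ₁) *
          (Polynomial.X - Polynomial.C Λ₂) ∧
      ‖Λ₁‖ < 1 ∧ ‖Λ₂‖ < 1 ∧
      (Λ₁ ≠ Λ₂ → ∀ k : ℕ, 1 ≤ k → (corr ξ ω (2 * k) : ℂ) =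
        -((Λ₁ ^ k - Λ₂ ^ k) * (((pl : ℂ) + pr) ^ 2 - pl * pr * (1 + pl + pr)) +
            (Λ₁ ^ (k - 1) - Λ₂ ^ (k - 1)) * (pl * pr * ((pl : ℂ) + pr))) /
          ((1 + (pl : ℂ) + pr) ^ 2 * (Λ₁ - Λ₂))) ∧
      (Λ₁ = Λ₂ → ∀ k : ℕ, 1 ≤ k → (corr ξ ω (2 * k) : ℂ) =
        -((k : ℂ) * Λ₁ ^ (k - 1) * (((pl : ℂ) + pr) ^ 2 - pl * pr * (1 + pl + pr)) +
            ((k - 1 : ℕ) : ℂ) * Λ₁ ^ (k - 2) * (pl * pr * ((pl : ℂ) + pr))) /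
          (1 + (pl : ℂ) + pr) ^ 2)) := by
  obtain ⟨x, y, h⟩ := exists_isFilling hξ hω
  obtain ⟨f1, f2, f3, f4⟩ := filling_ratios h
  obtain rfl : pl = x := hpl.trans f1
  obtain rfl : pr = y := hpr.trans f2
  have H := blockProb_eq h
  have hx := h.x_pos
  have hy := h.y_pos
  have hcorr : ∀ k : ℕ, 1 ≤ k → corr ξ ω (2 * k) = corrElement pl pr (k - 1) := by
    intro k hk
    obtain ⟨j, rfl⟩ : ∃ j, k = j + 1 := ⟨k - 1, by omega⟩
    exact corr_eq_sandwich hx hy H j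
  refine ⟨fun r w => ?_, ⟨hx, h.x_lt, hy, h.y_lt, f3.symm, f4.symm, h.xi_eq, h.omega_eq⟩,
    fun m => ⟨fun b => (timeState_support hx h.x_lt hy h.y_lt H b).1, sum_timeState hx hy H m,
      fun b => (timeState_support hx h.x_lt hy h.y_lt H b).2⟩,
    fun k b hb => ?_,
    fun m b => timeState_eq_sandwich hx hy H b, hcorr, ?_⟩
  · rw [H]
    exact tendsto_ringProb h r w
  · rw [timeState_markov hx hy H b hb]
    simp [pad]
  intro δ Λ₁ Λ₂ hδ h1 h2
  have hs : Λ₁ + Λ₂ = -((pl : ℂ) + pr - pl * pr) := by rw [h1, h2]; ring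
  have hp : Λ₁ * Λ₂ = pl * pr := by
    rw [h1, h2]
    linear_combination (-1 / 4 : ℂ) * hδ
  have hz : ∀ z : ℂ, z = Λ₁ ∨ z = Λ₂ → ‖z‖ < 1 := by
    intro z hz
    refine norm_lt_one_of_quadratic hx h.x_lt hy h.y_lt ?_
    rcases hz with rfl | rfl
    · linear_combination z * hs - hp
    · linear_combination z * hs - hp
  refine ⟨charpoly_sumA pl pr hs hp, hz _ (Or.inl rfl), hz _ (Or.inr rfl), ?_, ?_⟩
  · intro hne k hk
    have hd : Λ₁ - Λ₂ ≠ 0 := sub_ne_zero.2 hne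
    rw [hcorr k hk, corrElement_eq hx hy (isLucas_of_ne hs hp hne), Nat.sub_add_cancel hk]
    field_simp
  · rintro rfl k hk
    -- For `k = 1` the exponent `k - 2` is truncated to 0, harmlessly, since its coefficient `k - 1`
    -- is 0.
    rw [hcorr k hk, corrElement_eq hx hy (isLucas_of_eq hs hp), Nat.sub_add_cancel hk,
      Nat.sub_sub]
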